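/- **Lemma (The Weak Reflection Lemma).** A forcing notion is a set $\mathbb P$ of conditions together with a reflexive and transitive relation $\le$; conditions are compatible if they have a common extension (lower bound) in $\mathbb P$. For an infinite cardinal $\kappa$, $\mathbb P$ is *$\kappa$-lattice* if every set of fewer than $\kappa$ pairwise compatible conditions has a greatest lower bound. For a set $M$, a condition $q\in\mathbb P$ is *strongly $M$-generic* if for every $q'\le q$ there is $\pi\in\mathbb P\cap M$ such that every $r\in\mathbb P\cap M$ with $r\le\pi$ is compatible with $q'$. A set $M$ is *$\kappa$-closed* if for every ordinal $\alpha<\kappa$ every function $f\colon\alpha\to M$ is an element of $M$. Let $H(\chi)$ be the collection of sets whose transitive closure has size less than $\chi$. $\mathbb P$ is *$\kappa$-strongly proper* if for every cardinal $\chi$ and every $\kappa$-closed $M\prec H(\chi)$ of size $\kappa$ with $\mathbb P\in M$, every $p\in\mathbb P\cap M$ has an extension $q\le p$ which is strongly $M$-generic. For a family $\mathcal D$ of subsets of $\mathbb P$, a *$\mathcal D$-generic filter* is a filter on $\mathbb P$ (a nonempty, upward closed, downward directed subset) that meets every member of $\mathcal D$. A set $D\subseteq\mathbb P$ is *dense*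 if every condition has an extension in $D$, and *open* if it is closed under extensions. Let $\kappa$ be a regular (infinite) cardinal with $\kappa^{<\kappa}=\kappa$. Let $\mathbb P$ be a $\kappa$-lattice and $\kappa$-strongly proper forcing notion, and let $\mathcal D=\{D_\alpha\mid\alpha<\kappa^+\}$ be a family of dense open subsets of $\mathbb P$. Then there are a set $\mathbb P^*\subseteq\mathbb P$ which, with the induced order, is a $\kappa$-lattice and $\kappa$-strongly proper forcing notion of size $\min(|\mathbb P|,2^\kappa)$ (so of size $2^\kappa$ whenever $|\mathbb P|\ge 2^\kappa$), and a family $\mathcal D^*=\{D^*_\alpha\mid\alpha<\kappa^+\}$ of dense subsets of $\mathbb P^*$, such that there is a $\mathcal D^*$-generic filter on $\mathbb P^*$ if and only if there is a $\mathcal D$-generic filter on $\mathbb P$. -/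

import Mathlib

universe u

open Cardinal FirstOrder

namespace WeakReflection

/-- The only relation symbol of the language of set theory is binary. -/
inductive MemRel : ℕ → Type
  | mem : MemRel 2

/-- The first-order language of set theory, with the single symbol `∈`. -/
def setLanguage : Language := ⟨fun _ => Empty, MemRel⟩

/-- Every class of sets is a structure for the language of set theory, `∈` being interpreted by
true membership. -/
instance memStructure (X : Set ZFSet.{u}) : setLanguage.Structure X where
  funMap := fun f => f.elim
  RelMap := fun r => match r with
    | .mem => fun v => (v 0 : ZFSet.{u}) ∈ (v 1 : ZFSet.{u})

/-- `M ≺ N`: `M ⊆ N` and the inclusion is elementary for the language of set theory. -/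
def IsElementarySubmodel (M N : Set ZFSet.{u}) : Prop :=
  ∃ j : M ↪ₑ[setLanguage] N, ∀ x : M, (j x : ZFSet.{u}) = x

/-- `H(χ)`, the sets whose transitive closure has size less than `χ`; equivalently, those
contained in a transitive set of size less than `χ`. -/
def H (χ : Cardinal.{u}) : Set ZFSet.{u} :=
  {x | ∃ t : ZFSet.{u}, t.IsTransitive ∧ x ⊆ t ∧ t.card < χ}

/-- A set `M` is `κ`-closed if for every ordinal `α < κ` each function `f : α → M` belongs
to `M`. -/
def IsClosedModel (κ : Cardinal.{u}) (M : ZFSet.{u}) : Prop :=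
  ∀ α : Ordinal.{u}, α < κ.ord → ∀ f : ZFSet.{u}, ZFSet.IsFunc α.toZFSet M f → f ∈ M

/-- A forcing notion: a set with a reflexive and transitive relation on it, given as a set of
ordered pairs. -/
structure Forcing where
  /-- the set of conditions -/
  carrier : ZFSet.{u}
  /-- the order, as a set of pairs `(p, q)` with `p ≤ q` -/
  rel : ZFSet.{u}
  rel_subset : rel ⊆ ZFSet.prod carrier carrier
  refl : ∀ p ∈ carrier, ZFSet.pair p p ∈ rel
  trans : ∀ p q r : ZFSet.{u}, ZFSet.pair p q ∈ rel → ZFSet.pair q r ∈ rel → ZFSet.pair p r ∈ rel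

namespace Forcing

/-- `p ≤ q`, that is, `p` extends `q`. -/
def le (P : Forcing.{u}) (p q : ZFSet.{u}) : Prop := ZFSet.pair p q ∈ P.rel

/-- The forcing notion as one set, the ordered pair of its underlying set and its order. -/
def code (P : Forcing.{u}) : ZFSet.{u} := ZFSet.pair P.carrier P.rel

/-- `P` is a suborder of `Q`: a subset with the induced order. -/
def IsSuborder (P Q : Forcing.{u}) : Prop :=
  P.carrier ⊆ Q.carrier ∧ ∀ p ∈ P.carrier, ∀ q ∈ P.carrier, (P.le p q ↔ Q.le p q)

/-- Two conditions are compatible if they have a common extension. -/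
def Compatible (P : Forcing.{u}) (p q : ZFSet.{u}) : Prop :=
  ∃ r ∈ P.carrier, P.le r p ∧ P.le r q

/-- `g` is a greatest lower bound of the set of conditions `X`. -/
def IsGreatestLowerBound (P : Forcing.{u}) (X g : ZFSet.{u}) : Prop :=
  g ∈ P.carrier ∧ (∀ p ∈ X, P.le g p) ∧
    ∀ r ∈ P.carrier, (∀ p ∈ X, P.le r p) → P.le r g

/-- `κ`-lattice: each set of fewer than `κ` pairwise compatible conditions has a greatest lower
bound. -/
def IsLattice (κ : Cardinal.{u}) (P : Forcing.{u}) : Prop :=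
  ∀ X : ZFSet.{u}, X ⊆ P.carrier → X.card < κ → (∀ p ∈ X, ∀ q ∈ X, P.Compatible p q) →
    ∃ g, P.IsGreatestLowerBound X g

/-- `q` is a strongly `M`-generic condition of `P`. -/
def IsStronglyGeneric (P : Forcing.{u}) (M q : ZFSet.{u}) : Prop :=
  q ∈ P.carrier ∧ ∀ q' ∈ P.carrier, P.le q' q →
    ∃ π ∈ P.carrier, π ∈ M ∧ ∀ r ∈ P.carrier, r ∈ M → P.le r π → P.Compatible r q'

/-- `P` is strongly proper for the class `K` of models. -/
def IsStronglyProperFor (P : Forcing.{u}) (K : Set ZFSet.{u}) : Prop :=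
  ∀ (χ : Cardinal.{u}) (M : ZFSet.{u}), M ∈ K → IsElementarySubmodel (M : Set ZFSet.{u}) (H χ) →
    P.code ∈ M → ∀ p ∈ P.carrier, p ∈ M → ∃ q, P.le q p ∧ P.IsStronglyGeneric M q

/-- `κ`-strongly proper: strongly proper for the class of `κ`-closed models of size `κ`. -/
def IsStronglyProper (κ : Cardinal.{u}) (P : Forcing.{u}) : Prop :=
  P.IsStronglyProperFor {M | IsClosedModel κ M ∧ M.card = κ}

/-- `D` is a dense subset of `P`. -/
def IsDense (P : Forcing.{u}) (D : ZFSet.{u}) : Prop :=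
  D ⊆ P.carrier ∧ ∀ p ∈ P.carrier, ∃ d ∈ D, P.le d p

/-- `D` is closed under extending conditions. -/
def IsOpen (P : Forcing.{u}) (D : ZFSet.{u}) : Prop :=
  ∀ d ∈ D, ∀ p ∈ P.carrier, P.le p d → p ∈ D

/-- `G` is a filter on `P`: a nonempty, upward closed and downward directed set of conditions. -/
def IsFilter (P : Forcing.{u}) (G : ZFSet.{u}) : Prop :=
  G ⊆ P.carrier ∧ G.Nonempty ∧ (∀ p ∈ G, ∀ q ∈ P.carrier, P.le p q → q ∈ G) ∧
    ∀ p ∈ G, ∀ q ∈ G, ∃ r ∈ G, P.le r p ∧ P.le r q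

/-- `G` is a `D`-generic filter on `P`: a filter that meets each member of the family `D`. -/
def IsGenericFilter (P : Forcing.{u}) {ι : Type*} (D : ι → ZFSet.{u}) (G : ZFSet.{u}) : Prop :=
  P.IsFilter G ∧ ∀ i, ∃ p ∈ G, p ∈ D i

end Forcing

end WeakReflection

/-! If `P` has at most `2 ^ κ` conditions it serves as its own reflection. Otherwise build a set `N`
of size `2 ^ κ` that contains its subsets of size at most `κ` and is closed under a Skolem function
for some `H(θ)` with `P ∈ H(θ)`, under choices of greatest lower bounds and of strongly generic
conditions, and under the choices below; take for `P*` the order `P ∩ N`, and for the dense sets `D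
α ∩ N`. Greatest lower bounds in `N` make `P*` a `κ`-lattice and make compatibility in `P` and in
`P*` agree. A generic filter on `P*` generates one on `P`. Conversely `N` is closed under functions
choosing, for one fixed generic `G` (if any), its meetings with the `D α` and common extensions in
`G`; so `G ∩ N` is generic for `P*`.

The hard part is strong properness of `P*` (`IsReflectingSet.isStronglyProper_restrict`): a model `M
≺ H(χ)` with `P* ∈ M` need know nothing of `P`, `N` or `θ`, and `χ` may be too small for them. Since
`|N| ≤ |P*|`, the structure of `N` can be copied onto `C`, the underlying set of `P*`, as four
relations between subsets of `C` of size less than `κ` and elements of `C`. If `A ⊆ C` has size at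
most `κ` and is closed under them, then `A` is the trace on `C` of a `κ`-closed elementary submodel
of `H(θ)` of size `κ` containing `P`, which belongs to `N`; so strong properness of `P` gives
generics for `A` in `P*` (`IsReflectingSet.hasGenerics`). That such relations exist is a first-order
statement about `C` and its order in `H(χ)`, so `M` contains relations with this property, and `C ∩
M` is closed under them.

As `κ` need not be available in `M`, the statement must avoid it. The equality `|C| = 2 ^ κ` and `κ
^< κ = κ` help: a set `K` has size at least `κ` exactly when some `T ⊆ K × C` has distinct sections
at the elements of `C`. -/

namespace WeakReflection

/-! ### Cardinalities of sets -/

/-- The image of a set under an arbitrary function. -/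
noncomputable def img (f : ZFSet.{u} → ZFSet.{u}) (x : ZFSet.{u}) : ZFSet.{u} :=
  ZFSet.range fun a : x => f a

theorem mem_img {f : ZFSet.{u} → ZFSet.{u}} {x y : ZFSet.{u}} :
    y ∈ img f x ↔ ∃ a ∈ x, f a = y := by
  simp [img]

theorem lift_card (x : ZFSet.{u}) : lift.{u + 1} x.card = #x :=
  ZFSet.cardinalMk_coe_sort.symm

theorem card_le_of_injOn {x y : ZFSet.{u}} (f : ZFSet.{u} → ZFSet.{u}) (hf : ∀ a ∈ x, f a ∈ y)
    (hinj : ∀ a ∈ x, ∀ b ∈ x, f a = f b → a = b) : x.card ≤ y.card := by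
  rw [← lift_le.{u + 1}, lift_card, lift_card]
  refine mk_le_of_injective (f := fun a : x => (⟨f a, hf a a.2⟩ : y)) fun a b h => ?_
  exact Subtype.ext (hinj a a.2 b b.2 (congrArg Subtype.val h))

theorem card_img_le (f : ZFSet.{u} → ZFSet.{u}) (x : ZFSet.{u}) : (img f x).card ≤ x.card := by
  have h := ZFSet.lift_card_range_le (f := fun a : x => f a)
  rw [← lift_le.{u + 1}, lift_card x]
  rwa [lift_id'.{u, u + 1}] at h

theorem exists_equiv_of_card_eq {x y : ZFSet.{u}} (h : x.card = y.card) :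
    Nonempty (x ≃ y) := by
  rw [← Cardinal.eq, ← lift_card, ← lift_card, h]

theorem exists_subset_card_eq {x : ZFSet.{u}} {c : Cardinal.{u}} (h : c ≤ x.card) :
    ∃ y ⊆ x, y.card = c := by
  have h' : lift.{u + 1} c ≤ #(x : Set ZFSet.{u}) := by
    rw [show #(x : Set ZFSet.{u}) = #x from rfl, ← lift_card]; exact lift_le.2 h
  obtain ⟨s, hs, hc⟩ := le_mk_iff_exists_subset.1 h'
  refine ⟨x.sep (· ∈ s), ZFSet.sep_subset, ?_⟩
  rw [← lift_inj.{u, u + 1}, lift_card, ← hc]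
  refine mk_congr (Equiv.subtypeEquivRight fun a => ?_)
  simp only [ZFSet.mem_sep]
  exact ⟨fun h => h.2, fun h => ⟨hs h, h⟩⟩

theorem card_union_le_of_le {x y : ZFSet.{u}} {c : Cardinal.{u}} (hc : ℵ₀ ≤ c)
    (hx : x.card ≤ c) (hy : y.card ≤ c) : (x ∪ y).card ≤ c :=
  ZFSet.card_union_le.trans ((add_le_add hx hy).trans (add_eq_self hc).le)

theorem card_iUnion_le_of_le {α : Type u} {f : α → ZFSet.{u}} {c : Cardinal.{u}} (hc : ℵ₀ ≤ c)
    (hα : #α ≤ c) (hf : ∀ i, (f i).card ≤ c) : (ZFSet.iUnion f).card ≤ c := by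
  have h := ZFSet.lift_card_iUnion_le_sum_card (f := f)
  rw [lift_id] at h
  refine h.trans ((sum_le_sum _ (fun _ => c) hf).trans ?_)
  rw [sum_const']
  exact (mul_le_mul' hα le_rfl).trans (mul_eq_self hc).le

/-- The union of the sets `f a` for `a ∈ x`. -/
noncomputable def unionOver (x : ZFSet.{u}) (f : ZFSet.{u} → ZFSet.{u}) : ZFSet.{u} :=
  ZFSet.iUnion fun a : Shrink.{u} x => f ((equivShrink x).symm a : x)

theorem mem_unionOver {x y : ZFSet.{u}} {f : ZFSet.{u} → ZFSet.{u}} :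
    y ∈ unionOver x f ↔ ∃ a ∈ x, y ∈ f a := by
  simp only [unionOver, ZFSet.mem_iUnion]
  constructor
  · rintro ⟨a, ha⟩
    exact ⟨_, ((equivShrink x).symm a).2, ha⟩
  · rintro ⟨a, ha, hy⟩
    exact ⟨equivShrink x ⟨a, ha⟩, by simpa using hy⟩

theorem card_unionOver_le {x : ZFSet.{u}} {f : ZFSet.{u} → ZFSet.{u}} {c : Cardinal.{u}}
    (hc : ℵ₀ ≤ c) (hx : x.card ≤ c) (hf : ∀ a ∈ x, (f a).card ≤ c) :
    (unionOver x f).card ≤ c :=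
  card_iUnion_le_of_le hc hx fun a => hf _ ((equivShrink x).symm a).2

/-- The subsets of `x` of size at most `c`. -/
noncomputable def subsetsLE (c : Cardinal.{u}) (x : ZFSet.{u}) : ZFSet.{u} :=
  x.powerset.sep fun b => b.card ≤ c

theorem mem_subsetsLE {c : Cardinal.{u}} {x b : ZFSet.{u}} :
    b ∈ subsetsLE c x ↔ b ⊆ x ∧ b.card ≤ c := by
  simp [subsetsLE]

theorem card_subsetsLE_le {κ : Cardinal.{u}} (hκ : ℵ₀ ≤ κ) {x : ZFSet.{u}}
    (hx : x.card ≤ 2 ^ κ) : (subsetsLE κ x).card ≤ 2 ^ κ := by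
  have h1 : (subsetsLE κ x).card ≤ max x.card ℵ₀ ^ κ := by
    rw [← lift_le.{u + 1}, lift_card]
    have h2 := mk_bounded_subset_le (x : Set ZFSet.{u}) (lift.{u + 1} κ)
    rw [show #(x : Set ZFSet.{u}) = #x from rfl, ← lift_card] at h2
    refine le_trans ?_ (h2.trans ?_)
    · refine mk_le_of_injective (f := fun b : subsetsLE κ x => ⟨((b : ZFSet.{u}) : Set ZFSet.{u}),
        ?_, ?_⟩) fun a b h => ?_
      · exact fun y hy => (mem_subsetsLE.1 b.2).1 hy
      · rw [show #((b : ZFSet.{u}) : Set ZFSet.{u}) = #(b : ZFSet.{u}) from rfl, ← lift_card]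
        exact lift_le.2 (mem_subsetsLE.1 b.2).2
      · exact Subtype.ext (SetLike.coe_injective (congrArg Subtype.val h))
    · simp
  refine h1.trans ?_
  have h3 : max x.card ℵ₀ ≤ 2 ^ κ := max_le hx (hκ.trans (cantor κ).le)
  calc max x.card ℵ₀ ^ κ ≤ (2 ^ κ) ^ κ := power_le_power_right h3
    _ = 2 ^ κ := by rw [← power_mul, mul_eq_self hκ]

theorem card_upair_lt (x y : ZFSet.{u}) {c : Cardinal.{u}} (hc : ℵ₀ ≤ c) :
    ({x, y} : ZFSet.{u}).card < c := by
  refine lt_of_le_of_lt ZFSet.card_insert_le ?_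
  rw [ZFSet.card_singleton]
  exact (add_lt_aleph0 one_lt_aleph0 one_lt_aleph0).trans_le hc

/-! ### Closing off a set under an operation on its small subsets -/

/-- Iterate the closure step `κ⁺` times. Since `(2 ^ κ) ^ κ = 2 ^ κ` and `κ⁺ ≤ 2 ^ κ`, the size
stays bounded; since `κ⁺` is regular, a subset of the union of size at most `κ` already appears at
some stage. -/
theorem exists_closed_under {κ : Cardinal.{u}} (hκ : ℵ₀ ≤ κ) (Φ : ZFSet.{u} → ZFSet.{u})
    (hΦ : ∀ b, (Φ b).card ≤ 2 ^ κ) :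
    ∃ N : ZFSet.{u}, N.card ≤ 2 ^ κ ∧ ∀ b ⊆ N, b.card ≤ κ → Φ b ⊆ N := by
  have h2 : ℵ₀ ≤ (2 : Cardinal.{u}) ^ κ := hκ.trans (cantor κ).le
  let I := (Order.succ κ).ord.ToType
  let stp : ZFSet.{u} → ZFSet.{u} := fun x => x ∪ unionOver (subsetsLE κ x) Φ
  let S : I → ZFSet.{u} := (wellFounded_lt (α := I)).fix
    fun i rec => ZFSet.iUnion fun j : Set.Iio i => stp (rec j j.2)
  have hS : ∀ i, S i = ZFSet.iUnion fun j : Set.Iio i => stp (S j) :=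
    fun i => WellFounded.fix_eq _ _ i
  have hI : #I ≤ 2 ^ κ := by
    rw [mk_toType, card_ord]; exact Order.succ_le_of_lt (cantor κ)
  have hcard : ∀ i, (S i).card ≤ 2 ^ κ := by
    intro i
    induction i using (wellFounded_lt (α := I)).induction with
    | _ i ih =>
      rw [hS]
      refine card_iUnion_le_of_le h2 ((mk_subtype_le _).trans hI) fun j => ?_
      exact card_union_le_of_le h2 (ih j j.2)
        (card_unionOver_le h2 (card_subsetsLE_le hκ (ih j j.2)) fun a _ => hΦ a)
  have hsub : ∀ i j, i < j → stp (S i) ⊆ S j := by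
    intro i j hij y hy
    rw [hS j, ZFSet.mem_iUnion]
    exact ⟨⟨i, hij⟩, hy⟩
  refine ⟨ZFSet.iUnion S, card_iUnion_le_of_le h2 hI hcard, fun b hb hbκ => ?_⟩
  have hex : ∀ a : Shrink.{u} b, ∃ i, (((equivShrink b).symm a : b) : ZFSet.{u}) ∈ S i := fun a =>
    ZFSet.mem_iUnion.1 (hb ((equivShrink b).symm a).2)
  choose g hg using hex
  have hbdd : ∀ s : Set I, #s ≤ κ → ∃ m : I, ∀ x ∈ s, x < m := by
    intro s hs
    by_contra hcon
    have hcof : IsCofinal s := fun a => by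
      by_contra hb
      exact hcon ⟨a, fun x hx => lt_of_not_ge fun hax => hb ⟨x, hx, hax⟩⟩
    have h1 := (Order.cof_le hcof).trans hs
    rw [Ordinal.cof_toType, (isRegular_succ hκ).cof_ord] at h1
    exact (Order.lt_succ κ).not_ge h1
  obtain ⟨m, hm⟩ : ∃ m : I, ∀ a, g a < m := by
    obtain ⟨m, hm⟩ := hbdd (Set.range g) (mk_range_le.trans hbκ)
    exact ⟨m, fun a => hm _ ⟨a, rfl⟩⟩
  have hbm : b ⊆ S m := by
    intro y hy
    have h := hg (equivShrink b ⟨y, hy⟩)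
    simp only [Equiv.symm_apply_apply] at h
    exact hsub _ _ (hm _) (ZFSet.mem_union.2 (Or.inl h))
  obtain ⟨m', hm'⟩ : ∃ m' : I, m < m' := by
    obtain ⟨m', hm'⟩ := hbdd {m} ((mk_singleton m).le.trans (one_le_aleph0.trans hκ))
    exact ⟨m', hm' m rfl⟩
  intro y hy
  refine ZFSet.mem_iUnion.2 ⟨m', hsub m m' hm' (ZFSet.mem_union.2 (Or.inr ?_))⟩
  exact mem_unionOver.2 ⟨b, mem_subsetsLE.2 ⟨hbm, hbκ⟩, hy⟩

/-! ### The sets `H(χ)` -/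

theorem mem_H_of_subset {χ : Cardinal.{u}} {x y : ZFSet.{u}} (h : x ⊆ y) (hy : y ∈ H χ) :
    x ∈ H χ := by
  obtain ⟨t, ht, hyt, hc⟩ := hy
  exact ⟨t, ht, fun _ ha => hyt (h ha), hc⟩

theorem mem_H_of_mem {χ : Cardinal.{u}} {x y : ZFSet.{u}} (h : x ∈ y) (hy : y ∈ H χ) :
    x ∈ H χ := by
  obtain ⟨t, ht, hyt, hc⟩ := hy
  exact ⟨t, ht, ht.subset_of_mem (hyt h), hc⟩

theorem card_lt_of_mem_H {χ : Cardinal.{u}} {x : ZFSet.{u}} (h : x ∈ H χ) : x.card < χ := by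
  obtain ⟨t, -, hxt, hc⟩ := h
  exact (ZFSet.card_mono hxt).trans_lt hc

/-- A set together with all unordered pairs of its elements. -/
noncomputable def withPairs (t : ZFSet.{u}) : ZFSet.{u} :=
  t ∪ unionOver t fun a => img (fun b => {a, b}) t

theorem mem_withPairs {t x : ZFSet.{u}} :
    x ∈ withPairs t ↔ x ∈ t ∨ ∃ a ∈ t, ∃ b ∈ t, {a, b} = x := by
  simp only [withPairs, ZFSet.mem_union, mem_unionOver, mem_img]

theorem isTransitive_withPairs {t : ZFSet.{u}} (ht : t.IsTransitive) :
    (withPairs t).IsTransitive := by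
  intro x hx y hy
  rcases mem_withPairs.1 hx with hx | ⟨a, ha, b, hb, rfl⟩
  · exact mem_withPairs.2 (Or.inl (ht.subset_of_mem hx hy))
  · rcases ZFSet.mem_pair.1 hy with rfl | rfl
    · exact mem_withPairs.2 (Or.inl ha)
    · exact mem_withPairs.2 (Or.inl hb)

theorem card_withPairs_lt {χ : Cardinal.{u}} (hχ : ℵ₀ < χ) {t : ZFSet.{u}} (ht : t.card < χ) :
    (withPairs t).card < χ := by
  have hc : ℵ₀ ≤ max ℵ₀ t.card := le_max_left _ _
  refine lt_of_le_of_lt ?_ (max_lt hχ ht)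
  exact card_union_le_of_le hc (le_max_right _ _)
    (card_unionOver_le hc (le_max_right _ _) fun _ _ => (card_img_le _ _).trans (le_max_right _ _))

theorem prod_mem_H {χ : Cardinal.{u}} (hχ : ℵ₀ < χ) {x y : ZFSet.{u}} (hx : x ∈ H χ)
    (hy : y ∈ H χ) : ZFSet.prod x y ∈ H χ := by
  obtain ⟨t, ht, hxt, hc⟩ := hx
  obtain ⟨s, hs, hys, hd⟩ := hy
  have hts : (t ∪ s).card < χ := ZFSet.card_union_le.trans_lt (add_lt_of_lt hχ.le hc hd)
  refine ⟨withPairs (withPairs (t ∪ s)), isTransitive_withPairs (isTransitive_withPairs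
    (ht.union hs)), fun z hz => ?_, card_withPairs_lt hχ (card_withPairs_lt hχ hts)⟩
  obtain ⟨a, ha, b, hb, rfl⟩ := ZFSet.mem_prod.1 hz
  have ha' : a ∈ t ∪ s := ZFSet.mem_union.2 (Or.inl (hxt ha))
  have hb' : b ∈ t ∪ s := ZFSet.mem_union.2 (Or.inr (hys hb))
  refine mem_withPairs.2 (Or.inr ⟨{a}, mem_withPairs.2 (Or.inr ⟨a, ha', a, ha', ?_⟩), {a, b},
    mem_withPairs.2 (Or.inr ⟨a, ha', b, hb', rfl⟩), rfl⟩)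
  exact ZFSet.pair_eq_singleton a

/-- This places every relation between small subsets of `C` and elements of `C` in `H(χ)`, however
little `χ` exceeds `2 ^ κ`. -/
theorem subsetsLE_mem_H {χ κ : Cardinal.{u}} (hκ : ℵ₀ ≤ κ) (hχ : 2 ^ κ < χ) {x : ZFSet.{u}}
    (hx : x ∈ H χ) (hxκ : x.card ≤ 2 ^ κ) : subsetsLE κ x ∈ H χ := by
  obtain ⟨t, ht, hxt, hc⟩ := hx
  have hχ' : ℵ₀ ≤ χ := hκ.trans ((cantor κ).le.trans hχ.le)
  refine ⟨t ∪ subsetsLE κ x, ?_, fun z hz => ZFSet.mem_union.2 (Or.inr hz),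
    ZFSet.card_union_le.trans_lt (add_lt_of_lt hχ' hc ((card_subsetsLE_le hκ hxκ).trans_lt hχ))⟩
  intro y hy z hz
  rcases ZFSet.mem_union.1 hy with hy | hy
  · exact ZFSet.mem_union.2 (Or.inl (ht.subset_of_mem hy hz))
  · exact ZFSet.mem_union.2 (Or.inl (hxt ((mem_subsetsLE.1 hy).1 hz)))

/-- A union of at most `μ` transitive sets of size at most `μ` is transitive of size at most `μ`.
This is why `θ` is later taken to be a successor cardinal. -/
theorem mem_H_succ_of_card_le {μ : Cardinal.{u}} (hμ : ℵ₀ ≤ μ) {b : ZFSet.{u}}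
    (hb : ∀ x ∈ b, x ∈ H (Order.succ μ)) (hc : b.card ≤ μ) : b ∈ H (Order.succ μ) := by
  choose! t ht hxt htc using hb
  refine ⟨b ∪ unionOver b t, ?_, fun z hz => ZFSet.mem_union.2 (Or.inl hz), ?_⟩
  · intro y hy z hz
    refine ZFSet.mem_union.2 (Or.inr (mem_unionOver.2 ?_))
    rcases ZFSet.mem_union.1 hy with hy | hy
    · exact ⟨y, hy, hxt y hy hz⟩
    · obtain ⟨a, ha, hya⟩ := mem_unionOver.1 hy
      exact ⟨a, ha, (ht a ha).subset_of_mem hya hz⟩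
  · exact Order.lt_succ_of_le (card_union_le_of_le hμ hc
      (card_unionOver_le hμ hc fun a ha => Order.le_of_lt_succ (htc a ha)))

theorem exists_mem_H_succ (κ : Cardinal.{u}) (x : ZFSet.{u}) :
    ∃ μ, κ ≤ μ ∧ x ∈ H (Order.succ μ) :=
  ⟨max κ (ZFSet.vonNeumann x.rank).card, le_max_left _ _, ZFSet.vonNeumann x.rank,
    ZFSet.isTransitive_vonNeumann _, ZFSet.subset_vonNeumann_self x,
    Order.lt_succ_of_le (le_max_right _ _)⟩

/-! ### Formulas of the language of set theory -/

/-- The membership symbol. -/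
def memSymbol : setLanguage.Relations 2 := MemRel.mem

/-- The formula `xᵢ ∈ xⱼ`. -/
def memF (i j : ℕ) : setLanguage.Formula ℕ :=
  memSymbol.formula₂ (Language.Term.var i) (Language.Term.var j)

/-- The formula `xᵢ = xⱼ`. -/
def eqF (i j : ℕ) : setLanguage.Formula ℕ :=
  Language.Term.equal (Language.Term.var i) (Language.Term.var j)

/-- The formula `∀ xₖ, φ`. -/
noncomputable def allF (k : ℕ) (φ : setLanguage.Formula ℕ) : setLanguage.Formula ℕ :=
  Language.Formula.iAlls Unit (φ.relabel fun i => if i = k then Sum.inr () else Sum.inl i)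

/-- The formula `∃ xₖ, φ`. -/
noncomputable def exF (k : ℕ) (φ : setLanguage.Formula ℕ) : setLanguage.Formula ℕ :=
  Language.Formula.iExs Unit (φ.relabel fun i => if i = k then Sum.inr () else Sum.inl i)

section Realize

variable {X : Set ZFSet.{u}} (v : ℕ → X)

theorem realize_memF (i j : ℕ) : (memF i j).Realize v ↔ (v i : ZFSet.{u}) ∈ (v j : ZFSet.{u}) := by
  rw [memF, Language.Formula.realize_rel₂]
  rfl

theorem realize_eqF (i j : ℕ) : (eqF i j).Realize v ↔ (v i : ZFSet.{u}) = v j := by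
  rw [eqF, Language.Formula.realize_equal, ← Subtype.ext_iff]
  rfl

theorem sumElim_comp_eq_update (k : ℕ) (f : Unit → X) :
    (Sum.elim v f ∘ fun i => if i = k then Sum.inr () else Sum.inl i) =
      Function.update v k (f ()) := by
  funext i
  by_cases h : i = k
  · subst h; simp
  · simp [h]

theorem realize_allF (k : ℕ) (φ : setLanguage.Formula ℕ) :
    (allF k φ).Realize v ↔ ∀ x : X, φ.Realize (Function.update v k x) := by
  simp only [allF, Language.Formula.realize_iAlls, Language.Formula.realize_relabel]
  constructor
  · intro h x
    have := h fun _ => x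
    rwa [← sumElim_comp_eq_update v k fun _ => x]
  · intro h f
    have := h (f ())
    rwa [← sumElim_comp_eq_update v k f] at this

theorem realize_exF (k : ℕ) (φ : setLanguage.Formula ℕ) :
    (exF k φ).Realize v ↔ ∃ x : X, φ.Realize (Function.update v k x) := by
  simp only [exF, Language.Formula.realize_iExs, Language.Formula.realize_relabel]
  constructor
  · rintro ⟨f, h⟩
    refine ⟨f (), ?_⟩
    rwa [← sumElim_comp_eq_update v k f]
  · rintro ⟨x, h⟩
    refine ⟨fun _ => x, ?_⟩
    rwa [← sumElim_comp_eq_update v k fun _ => x] at h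

/-- The formula saying that `xₖ` is the unordered pair of `xᵢ` and `xⱼ`. -/
noncomputable def upairF (k i j : ℕ) : setLanguage.Formula ℕ :=
  -- The variables 100 to 102 are reserved for bound variables of the pairing formulas; the bounds
  -- on indices in the lemmas below prevent capture.
  memF i k ⊓ memF j k ⊓ allF 100 ((memF 100 k).imp (eqF 100 i ⊔ eqF 100 j))

/-- The formula saying that the ordered pair of `xᵢ` and `xⱼ` is `xₖ`. -/
noncomputable def pairF (k i j : ℕ) : setLanguage.Formula ℕ :=
  exF 101 (memF 101 k ⊓ upairF 101 i i) ⊓ exF 101 (memF 101 k ⊓ upairF 101 i j) ⊓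
    allF 101 ((memF 101 k).imp (upairF 101 i i ⊔ upairF 101 i j))

/-- The formula saying that the ordered pair of `xᵢ` and `xⱼ` belongs to `xₖ`. -/
noncomputable def pairMemF (i j k : ℕ) : setLanguage.Formula ℕ :=
  exF 102 (memF 102 k ⊓ pairF 102 i j)

theorem realize_upairF (hX : ∀ x ∈ X, ∀ y ∈ x, y ∈ X) {k i j : ℕ} (hk : k ≠ 100) (hi : i ≠ 100)
    (hj : j ≠ 100) :
    (upairF k i j).Realize v ↔ (v k : ZFSet.{u}) = {(v i : ZFSet.{u}), (v j : ZFSet.{u})} := by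
  simp only [upairF, Language.Formula.realize_inf, Language.Formula.realize_imp,
    Language.Formula.realize_sup, realize_memF, realize_eqF, realize_allF, Function.update_self,
    Function.update_of_ne hk, Function.update_of_ne hi, Function.update_of_ne hj]
  constructor
  · rintro ⟨⟨h1, h2⟩, h3⟩
    ext z
    rw [ZFSet.mem_pair]
    constructor
    · exact fun hz => h3 ⟨z, hX _ (v k).2 z hz⟩ hz
    · rintro (rfl | rfl) <;> assumption
  · intro h
    rw [h]
    simp

theorem realize_pairF (hX : ∀ x ∈ X, ∀ y ∈ x, y ∈ X) {k i j : ℕ} (hk : k ≠ 101)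
    (hi : i < 100) (hj : j < 100) :
    (pairF k i j).Realize v ↔ (v k : ZFSet.{u}) = ZFSet.pair (v i : ZFSet.{u}) (v j) := by
  have hi' : i ≠ 100 := hi.ne
  have hj' : j ≠ 100 := hj.ne
  have hi2 : i ≠ 101 := by omega
  have hj2 : j ≠ 101 := by omega
  simp only [pairF, Language.Formula.realize_inf, Language.Formula.realize_imp,
    Language.Formula.realize_sup, realize_memF, realize_allF, realize_exF,
    realize_upairF _ hX (show 101 ≠ 100 by decide) hi' hi',
    realize_upairF _ hX (show 101 ≠ 100 by decide) hi' hj', Function.update_self,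
    Function.update_of_ne hk, Function.update_of_ne hi2, Function.update_of_ne hj2]
  constructor
  · rintro ⟨⟨⟨a, ha, ha'⟩, b, hb, hb'⟩, h3⟩
    ext z
    rw [ZFSet.pair, ZFSet.mem_pair, ← ZFSet.pair_eq_singleton]
    constructor
    · exact fun hz => h3 ⟨z, hX _ (v k).2 z hz⟩ hz
    · rintro (rfl | rfl)
      · rwa [← ha']
      · rwa [← hb']
  · intro h
    have h1 : ∀ z : ZFSet.{u}, z ∈ (v k : ZFSet.{u}) ↔
        z = {(v i : ZFSet.{u}), (v i : ZFSet.{u})} ∨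
          z = {(v i : ZFSet.{u}), (v j : ZFSet.{u})} := by
      intro z
      rw [h, ZFSet.pair, ZFSet.mem_pair, ZFSet.pair_eq_singleton]
    refine ⟨⟨⟨⟨_, hX _ (v k).2 _ ((h1 _).2 (Or.inl rfl))⟩, (h1 _).2 (Or.inl rfl), rfl⟩,
      ⟨_, hX _ (v k).2 _ ((h1 _).2 (Or.inr rfl))⟩, (h1 _).2 (Or.inr rfl), rfl⟩,
      fun x hx => (h1 _).1 hx⟩

theorem realize_pairMemF (hX : ∀ x ∈ X, ∀ y ∈ x, y ∈ X) {i j k : ℕ} (hi : i < 100)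
    (hj : j < 100) (hk : k < 100) :
    (pairMemF i j k).Realize v ↔ ZFSet.pair (v i : ZFSet.{u}) (v j) ∈ (v k : ZFSet.{u}) := by
  simp only [pairMemF, Language.Formula.realize_inf, realize_memF, realize_exF,
    realize_pairF _ hX (show 102 ≠ 101 by decide) hi hj, Function.update_self,
    Function.update_of_ne (show k ≠ 102 by omega), Function.update_of_ne (show i ≠ 102 by omega),
    Function.update_of_ne (show j ≠ 102 by omega)]
  constructor
  · rintro ⟨z, hz, h⟩
    rwa [← h]
  · intro h
    exact ⟨⟨_, hX _ (v k).2 _ h⟩, h, rfl⟩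

end Realize

/-! ### Elementary submodels -/

theorem IsElementarySubmodel.subset {M N : Set ZFSet.{u}} (h : IsElementarySubmodel M N) :
    M ⊆ N := by
  obtain ⟨j, hj⟩ := h
  intro x hx
  have := (j ⟨x, hx⟩).2
  rwa [hj] at this

theorem IsElementarySubmodel.realize_iff {M N : Set ZFSet.{u}} (h : IsElementarySubmodel M N)
    (φ : setLanguage.Formula ℕ) (v : ℕ → M) :
    φ.Realize (fun i => (⟨v i, h.subset (v i).2⟩ : N)) ↔ φ.Realize v := by
  obtain ⟨j, hj⟩ := h
  rw [← j.map_formula φ v]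
  have : (j ∘ v) = fun i => (⟨v i, IsElementarySubmodel.subset ⟨j, hj⟩ (v i).2⟩ : N) :=
    funext fun i => Subtype.ext (hj (v i))
  rw [this]

/-- A formula with parameters in an elementary submodel that has a solution has one in the
submodel. -/
theorem IsElementarySubmodel.exists_mem {M N : Set ZFSet.{u}} (h : IsElementarySubmodel M N)
    (φ : setLanguage.Formula ℕ) (v : ℕ → N) (hv : ∀ i, (v i : ZFSet.{u}) ∈ M) (k : ℕ) (x : N)
    (hx : φ.Realize (Function.update v k x)) :
    ∃ y : N, (y : ZFSet.{u}) ∈ M ∧ φ.Realize (Function.update v k y) := by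
  have h1 := (h.realize_iff (exF k φ) fun i => ⟨v i, hv i⟩).1 ((realize_exF _ _ _).2 ⟨x, hx⟩)
  obtain ⟨y, hy⟩ := (realize_exF _ _ _).1 h1
  refine ⟨⟨y, h.subset y.2⟩, y.2, ?_⟩
  have h2 := (h.realize_iff φ _).2 hy
  convert h2 using 1
  funext i
  by_cases hi : i = k
  · subst hi; simp
  · simp [hi]

/-- A code for a natural number. -/
noncomputable def natCode : ℕ → ZFSet.{u}
  | 0 => ∅
  | n + 1 => {natCode n}

theorem natCode_injective : Function.Injective natCode.{u} := by
  have hne : ∀ n, natCode.{u} (n + 1) ≠ natCode 0 := fun n h => by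
    have hn : natCode n ∈ natCode.{u} (n + 1) := ZFSet.mem_singleton.2 rfl
    rw [h] at hn
    exact ZFSet.notMem_empty _ hn
  intro m
  induction m with
  | zero =>
    intro n h
    cases n with
    | zero => rfl
    | succ n => exact absurd h.symm (hne n)
  | succ m ih =>
    intro n h
    cases n with
    | zero => exact absurd h (hne m)
    | succ n => exact congrArg _ (ih (ZFSet.singleton_injective h))

/-- A code for a finite sequence of sets. -/
noncomputable def listCode : List ZFSet.{u} → ZFSet.{u}
  | [] => ∅
  | a :: l => ZFSet.pair a (listCode l)

theorem pair_ne_empty (a b : ZFSet.{u}) : ZFSet.pair a b ≠ ∅ := fun h =>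
  ZFSet.notMem_empty {a} (h ▸ ZFSet.mem_pair.2 (Or.inl rfl))

theorem listCode_injective : Function.Injective listCode.{u} := by
  intro l
  induction l with
  | nil =>
    intro m h
    cases m with
    | nil => rfl
    | cons b m => exact absurd h.symm (pair_ne_empty _ _)
  | cons a l ih =>
    intro m h
    cases m with
    | nil => exact absurd h (pair_ne_empty _ _)
    | cons b m =>
      obtain ⟨h1, h2⟩ := ZFSet.pair_inj.1 h
      rw [h1, ih h2]

/-- `M` contains its subsets of size less than `κ`. -/
def ContainsSmallSubsets (κ : Cardinal.{u}) (M : ZFSet.{u}) : Prop :=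
  ∀ b ⊆ M, b.card < κ → b ∈ M

namespace ContainsSmallSubsets

variable {κ : Cardinal.{u}} {M : ZFSet.{u}}

theorem upair_mem (hM : ContainsSmallSubsets κ M) (hκ : ℵ₀ ≤ κ) {a b : ZFSet.{u}}
    (ha : a ∈ M) (hb : b ∈ M) : ({a, b} : ZFSet.{u}) ∈ M := by
  refine hM _ (fun z hz => ?_) (card_upair_lt a b hκ)
  rcases ZFSet.mem_pair.1 hz with rfl | rfl <;> assumption

theorem pair_mem (hM : ContainsSmallSubsets κ M) (hκ : ℵ₀ ≤ κ) {a b : ZFSet.{u}}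
    (ha : a ∈ M) (hb : b ∈ M) : ZFSet.pair a b ∈ M := by
  refine hM.upair_mem hκ ?_ (hM.upair_mem hκ ha hb)
  rw [← ZFSet.pair_eq_singleton]
  exact hM.upair_mem hκ ha ha

theorem empty_mem (hM : ContainsSmallSubsets κ M) (hκ : ℵ₀ ≤ κ) : ∅ ∈ M :=
  hM _ (ZFSet.empty_subset M) (by rw [ZFSet.card_empty]; exact aleph0_pos.trans_le hκ)

theorem natCode_mem (hM : ContainsSmallSubsets κ M) (hκ : ℵ₀ ≤ κ) (n : ℕ) : natCode n ∈ M := by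
  induction n with
  | zero => exact hM.empty_mem hκ
  | succ n ih =>
    rw [natCode, ← ZFSet.pair_eq_singleton]
    exact hM.upair_mem hκ ih ih

theorem listCode_mem (hM : ContainsSmallSubsets κ M) (hκ : ℵ₀ ≤ κ) (l : List ZFSet.{u})
    (hl : ∀ a ∈ l, a ∈ M) : listCode l ∈ M := by
  induction l with
  | nil => exact hM.empty_mem hκ
  | cons a l ih =>
    exact hM.pair_mem hκ (hl a List.mem_cons_self) (ih fun b hb => hl b (List.mem_cons_of_mem _ hb))

end ContainsSmallSubsets

theorem countable_formulas : Countable (Σ n, setLanguage.BoundedFormula Empty n) := by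
  have : Countable (Σ n, MemRel n) := by
    refine Function.Injective.countable (f := fun _ => ()) ?_
    rintro ⟨_, ⟨⟩⟩ ⟨_, ⟨⟩⟩ _
    rfl
  have : Countable (Σ n, setLanguage.Relations n) := this
  have : Countable (Σ n, setLanguage.Functions n) := by
    change Countable (Σ _ : ℕ, Empty); infer_instance
  infer_instance

/-- There is a single Skolem function for `H(θ)`: those sets of its elements that contain their
small subsets and are closed under it are elementary submodels. -/
theorem exists_skolem_function (θ : Cardinal.{u}) {c : ZFSet.{u}} (hc : c ∈ H θ) :
    ∃ Sk : ZFSet.{u} → ZFSet.{u}, (∀ z, Sk z ∈ H θ) ∧ Sk ∅ = c ∧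
      ∀ (κ : Cardinal.{u}) (M : ZFSet.{u}), ℵ₀ ≤ κ → (∀ x ∈ M, x ∈ H θ) →
        ContainsSmallSubsets κ M → (∀ x ∈ M, Sk x ∈ M) →
        IsElementarySubmodel (M : Set ZFSet.{u}) (H θ) := by
  classical
  obtain ⟨enc, henc⟩ := countable_formulas.exists_injective_nat
  -- A set `z` codes a request, namely a formula number and a list of parameters; `a` answers it if
  -- it satisfies the formula in the last variable.
  let Wit : ZFSet.{u} → H θ → Prop := fun z a =>
    ∃ (n : ℕ) (φ : setLanguage.BoundedFormula Empty (n + 1)) (x : Fin n → H θ),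
      z = ZFSet.pair (natCode (enc ⟨n + 1, φ⟩)) (listCode (List.ofFn fun i => (x i : ZFSet.{u}))) ∧
        φ.Realize default (Fin.snoc x a : Fin (n + 1) → H θ)
  let Sk : ZFSet.{u} → ZFSet.{u} := fun z => if h : ∃ a, Wit z a then (h.choose : ZFSet.{u}) else c
  refine ⟨Sk, fun z => ?_, ?_, fun κ M hκ hMθ hM hMS => ?_⟩
  · by_cases h : ∃ a, Wit z a
    · simp only [Sk, dif_pos h]; exact h.choose.2
    · simp only [Sk, dif_neg h]; exact hc
  -- The empty set is not a pair, hence codes no request, and the default value `c` is returned.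
  · have h : ¬ ∃ a, Wit ∅ a := by
      rintro ⟨a, n, φ, x, h, -⟩
      exact pair_ne_empty _ _ h.symm
    simp only [Sk, dif_neg h]
  · let f : (M : Set ZFSet.{u}) ↪[setLanguage] H θ :=
      { toFun := fun x => ⟨x, hMθ x x.2⟩
        inj' := fun a b h => Subtype.ext (congrArg (fun x : H θ => (x : ZFSet.{u})) h)
        map_fun' := fun g => nomatch g
        map_rel' := fun r x => by cases r; exact Iff.rfl }
    refine ⟨f.toElementaryEmbedding fun n φ x a ha => ?_, fun x => rfl⟩
    set z := ZFSet.pair (natCode (enc ⟨n + 1, φ⟩))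
      (listCode (List.ofFn fun i => ((f ∘ x) i : ZFSet.{u}))) with hz
    have hzM : z ∈ M := by
      refine hM.pair_mem hκ (hM.natCode_mem hκ _) (hM.listCode_mem hκ _ fun b hb => ?_)
      obtain ⟨i, rfl⟩ := (List.mem_ofFn' _ _).1 hb
      exact (x i).2
    have hex : ∃ a, Wit z a := ⟨a, n, φ, f ∘ x, rfl, ha⟩
    have hSk : Sk z = hex.choose := dif_pos hex
    -- The chosen answer comes with some formula and parameters of code `z`; injectivity of the
    -- coding identifies them with the given ones, which completes the Tarski–Vaught test.
    obtain ⟨m, ψ, y, hy, hr⟩ := hex.choose_spec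
    rw [hz] at hy
    obtain ⟨h1, h2⟩ := ZFSet.pair_inj.1 hy
    have h3 := henc (natCode_injective h1)
    obtain ⟨h4, h5⟩ := Sigma.mk.inj h3
    obtain rfl : n = m := Nat.succ_injective h4
    obtain rfl := eq_of_heq h5
    have h6 : f ∘ x = y := by
      funext i
      exact Subtype.ext (congrFun (List.ofFn_injective (listCode_injective h2)) i)
    refine ⟨⟨Sk z, hMS z hzM⟩, ?_⟩
    have h7 : f ⟨Sk z, hMS z hzM⟩ = hex.choose := Subtype.ext hSk
    rw [h7, h6]
    exact hr

/-! ### Separating families -/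

/-- The sections of `T` at the elements of `C` are distinct subsets of `K`. -/
def Separates (C K T : ZFSet.{u}) : Prop :=
  ∀ x ∈ C, ∀ y ∈ C, (∀ k ∈ K, ZFSet.pair k x ∈ T ↔ ZFSet.pair k y ∈ T) → x = y

theorem Separates.card_le {C K T : ZFSet.{u}} (h : Separates C K T) : C.card ≤ 2 ^ K.card := by
  rw [← ZFSet.card_powerset]
  refine card_le_of_injOn (fun x => K.sep fun k => ZFSet.pair k x ∈ T)
    (fun x _ => ZFSet.mem_powerset.2 ZFSet.sep_subset) fun x hx y hy hxy => ?_
  refine h x hx y hy fun k hk => ?_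
  have := congrArg (k ∈ ·) hxy
  simpa [hk] using this

theorem exists_separates {C K : ZFSet.{u}} (h : C.card ≤ 2 ^ K.card) :
    ∃ T ⊆ ZFSet.prod K C, Separates C K T := by
  rw [← ZFSet.card_powerset, ← lift_le.{u + 1}, lift_card, lift_card] at h
  obtain ⟨f⟩ := h
  refine ⟨(ZFSet.prod K C).sep fun z => ∃ k, ∃ x, ∃ hx : x ∈ C, z = ZFSet.pair k x ∧
    k ∈ (f ⟨x, hx⟩ : ZFSet.{u}), ZFSet.sep_subset, fun x hx y hy hxy => ?_⟩
  have key : ∀ z (hz : z ∈ C), ∀ k ∈ K, (ZFSet.pair k z ∈ (ZFSet.prod K C).sep fun z => ∃ k, ∃ x,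
      ∃ hx : x ∈ C, z = ZFSet.pair k x ∧ k ∈ (f ⟨x, hx⟩ : ZFSet.{u})) ↔
      k ∈ (f ⟨z, hz⟩ : ZFSet.{u}) := by
    intro z hz k hk
    rw [ZFSet.mem_sep, ZFSet.pair_mem_prod]
    constructor
    · rintro ⟨-, k', x', hx', he, hm⟩
      obtain ⟨rfl, rfl⟩ := ZFSet.pair_inj.1 he
      exact hm
    · exact fun hm => ⟨⟨hk, hz⟩, k, z, hz, rfl, hm⟩
  have hfe : f ⟨x, hx⟩ = f ⟨y, hy⟩ := by
    refine Subtype.ext (ZFSet.ext fun k => ?_)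
    have hs := fun z => ZFSet.mem_powerset.1 (f z).2
    constructor
    · intro hk
      have hkK := hs _ hk
      exact (key y hy k hkK).1 ((hxy k hkK).1 ((key x hx k hkK).2 hk))
    · intro hk
      have hkK := hs _ hk
      exact (key x hx k hkK).1 ((hxy k hkK).2 ((key y hy k hkK).2 hk))
  exact congrArg Subtype.val (f.injective hfe)

theorem two_power_lt_of_lt {κ c : Cardinal.{u}} (hreg : κ.IsRegular) (hκ : κ ^< κ = κ)
    (hc : c < κ) : (2 : Cardinal.{u}) ^ c < 2 ^ κ := by
  refine lt_of_le_of_lt ?_ (cantor κ)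
  calc (2 : Cardinal.{u}) ^ c ≤ κ ^ c :=
        power_le_power_right ((natCast_le_aleph0 (n := 2)).trans hreg.1)
    _ ≤ κ ^< κ := le_powerlt κ hc
    _ = κ := hκ

/-- Distinct sections give `2 ^ κ ≤ 2 ^ |K|`, whereas `c < κ` implies `2 ^ c ≤ κ ^< κ = κ < 2 ^ κ`.
-/
theorem le_card_of_separates {κ : Cardinal.{u}} (hreg : κ.IsRegular) (hκ : κ ^< κ = κ)
    {C K T : ZFSet.{u}} (hC : C.card = 2 ^ κ) (h : Separates C K T) : κ ≤ K.card := by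
  by_contra hlt
  have := h.card_le
  rw [hC] at this
  exact (two_power_lt_of_lt hreg hκ (not_le.1 hlt)).not_ge this

/-- The sets of size less than `κ` are those over which no member of `H(χ)` separates `C`. -/
theorem card_lt_iff_forall_not_separates {κ χ : Cardinal.{u}} (hreg : κ.IsRegular)
    (hκ : κ ^< κ = κ) (hχ : 2 ^ κ < χ) {C K : ZFSet.{u}} (hC : C.card = 2 ^ κ) (hCχ : C ∈ H χ)
    (hK : K ∈ H χ) : (∀ T ∈ H χ, ¬ Separates C K T) ↔ K.card < κ := by
  constructor
  · intro h
    by_contra hle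
    obtain ⟨T, hT, hs⟩ := exists_separates (C := C) (K := K)
      (hC.le.trans (power_le_power_left two_ne_zero (not_lt.1 hle)))
    exact h T (mem_H_of_subset hT
      (prod_mem_H ((hreg.1.trans_lt (cantor κ)).trans hχ) hK hCχ)) hs
  · intro h T _ hs
    exact (le_card_of_separates hreg hκ hC hs).not_gt h

/-! ### Reflecting relations -/

/-- `A` is closed under the relation `G` between small subsets of `C` and elements of `C`. -/
def ClosedUnder (small : ZFSet.{u} → Prop) (C A G : ZFSet.{u}) : Prop :=
  ∀ a y, ZFSet.pair a y ∈ G → y ∈ C → a ⊆ A → small a → ∃ y' ∈ A, ZFSet.pair a y' ∈ G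

/-- Every element of `A` has an extension in the order `R` on `C` that is strongly generic
for `A`. -/
def HasGenerics (C R A : ZFSet.{u}) : Prop :=
  ∀ p ∈ A, ∃ q ∈ C, ZFSet.pair q p ∈ R ∧ ∀ q' ∈ C, ZFSet.pair q' q ∈ R →
    ∃ π ∈ A, ∀ r ∈ A, ZFSet.pair r π ∈ R → ∃ s ∈ C, ZFSet.pair s r ∈ R ∧ ZFSet.pair s q' ∈ R

/-- `h` is a function from a subset of `K` onto a set including `A`. -/
def Covers (K A h : ZFSet.{u}) : Prop :=
  (∀ y ∈ A, ∃ k ∈ K, ZFSet.pair k y ∈ h) ∧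
    ∀ k y y', ZFSet.pair k y ∈ h → ZFSet.pair k y' ∈ h → y = y'

/-- `T` shows that `K` is not too small, and the subsets of `C` that are covered by `K` and closed
under the four relations have strongly generic conditions; all this as seen by `X`. -/
def Reflects (X : Set ZFSet.{u}) (C R K T G₀ G₁ G₂ G₃ : ZFSet.{u}) : Prop :=
  Separates C K T ∧ ∀ A ∈ X, ∀ h ∈ X, A ⊆ C → Covers K A h →
    ClosedUnder (fun a => ∀ T ∈ X, ¬ Separates C a T) C A G₀ →
    ClosedUnder (fun a => ∀ T ∈ X, ¬ Separates C a T) C A G₁ →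
    ClosedUnder (fun a => ∀ T ∈ X, ¬ Separates C a T) C A G₂ →
    ClosedUnder (fun a => ∀ T ∈ X, ¬ Separates C a T) C A G₃ → HasGenerics C R A

/-- The formula `∀ xₖ ∈ xⱼ, φ`. -/
noncomputable def ballF (k j : ℕ) (φ : setLanguage.Formula ℕ) : setLanguage.Formula ℕ :=
  allF k ((memF k j).imp φ)

/-- The formula `∃ xₖ ∈ xⱼ, φ`. -/
noncomputable def bexF (k j : ℕ) (φ : setLanguage.Formula ℕ) : setLanguage.Formula ℕ :=
  exF k (memF k j ⊓ φ)

/-- The formula for `Separates`, with `C` the variable `0`. -/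
noncomputable def separatesF (k t : ℕ) : setLanguage.Formula ℕ :=
  ballF 20 0 (ballF 21 0 ((ballF 22 k ((pairMemF 22 20 t).iff (pairMemF 22 21 t))).imp
    (eqF 20 21)))

/-- The formula for `ClosedUnder`, with `C`, `A` the variables `0`, `8`. -/
noncomputable def closedUnderF (g : ℕ) : setLanguage.Formula ℕ :=
  allF 10 (allF 11 ((pairMemF 10 11 g).imp ((memF 11 0).imp ((ballF 12 10 (memF 12 8)).imp
    ((allF 13 (separatesF 10 13).not).imp (bexF 14 8 (pairMemF 10 14 g)))))))

/-- The formula for `HasGenerics`, with `C`, `R`, `A` the variables `0`, `1`, `8`. -/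
noncomputable def hasGenericsF : setLanguage.Formula ℕ :=
  ballF 10 8 (bexF 11 0 (pairMemF 11 10 1 ⊓ ballF 12 0 ((pairMemF 12 11 1).imp
    (bexF 13 8 (ballF 14 8 ((pairMemF 14 13 1).imp
      (bexF 15 0 (pairMemF 15 14 1 ⊓ pairMemF 15 12 1))))))))

/-- The formula for `Covers`, with `K`, `A`, `h` the variables `2`, `8`, `9`. -/
noncomputable def coversF : setLanguage.Formula ℕ :=
  ballF 10 8 (bexF 11 2 (pairMemF 11 10 9)) ⊓
    allF 10 (allF 11 (allF 12 ((pairMemF 10 11 9).imp ((pairMemF 10 12 9).imp (eqF 11 12)))))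

/-- The formula for `Reflects`, with the sets in question the variables `0` to `7`. -/
noncomputable def reflectsF : setLanguage.Formula ℕ :=
  separatesF 2 3 ⊓ allF 8 (allF 9 ((ballF 10 8 (memF 10 0)).imp (coversF.imp
    ((closedUnderF 4).imp ((closedUnderF 5).imp ((closedUnderF 6).imp ((closedUnderF 7).imp
      hasGenericsF)))))))

section Realize

variable {X : Set ZFSet.{u}}

theorem mem_of_pair_mem (hX : ∀ x ∈ X, ∀ y ∈ x, y ∈ X) {x a b : ZFSet.{u}} (hx : x ∈ X)
    (h : ZFSet.pair a b ∈ x) : a ∈ X ∧ b ∈ X := by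
  have hp : ({a, b} : ZFSet.{u}) ∈ X :=
    hX _ (hX _ hx _ h) _ (ZFSet.mem_pair.2 (Or.inr rfl))
  exact ⟨hX _ hp _ (ZFSet.mem_pair.2 (Or.inl rfl)), hX _ hp _ (ZFSet.mem_pair.2 (Or.inr rfl))⟩

theorem realize_ballF (hX : ∀ x ∈ X, ∀ y ∈ x, y ∈ X) (v : ℕ → X) {k j : ℕ}
    (hkj : j ≠ k) (φ : setLanguage.Formula ℕ) :
    (ballF k j φ).Realize v ↔ ∀ x (hx : x ∈ (v j : ZFSet.{u})),
      φ.Realize (Function.update v k ⟨x, hX _ (v j).2 x hx⟩) := by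
  simp only [ballF, realize_allF, Language.Formula.realize_imp, realize_memF, Function.update_self,
    Function.update_of_ne hkj]
  exact ⟨fun h x hx => h ⟨x, _⟩ hx, fun h x hx => h x hx⟩

theorem realize_bexF (hX : ∀ x ∈ X, ∀ y ∈ x, y ∈ X) (v : ℕ → X) {k j : ℕ}
    (hkj : j ≠ k) (φ : setLanguage.Formula ℕ) :
    (bexF k j φ).Realize v ↔ ∃ x, ∃ hx : x ∈ (v j : ZFSet.{u}),
      φ.Realize (Function.update v k ⟨x, hX _ (v j).2 x hx⟩) := by
  simp only [bexF, realize_exF, Language.Formula.realize_inf, realize_memF, Function.update_self,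
    Function.update_of_ne hkj]
  exact ⟨fun ⟨x, hx, h⟩ => ⟨x, hx, h⟩, fun ⟨x, hx, h⟩ => ⟨⟨x, _⟩, hx, h⟩⟩

theorem realize_separatesF (hX : ∀ x ∈ X, ∀ y ∈ x, y ∈ X) (v : ℕ → X) {k t : ℕ}
    (hk : k < 20) (ht : t < 20) :
    (separatesF k t).Realize v ↔ Separates (v 0 : ZFSet.{u}) (v k) (v t) := by
  have h1 : k ≠ 20 := by omega
  have h2 : k ≠ 21 := by omega
  have h3 : k ≠ 22 := by omega
  have h4 : t ≠ 20 := by omega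
  have h5 : t ≠ 21 := by omega
  have h6 : t ≠ 22 := by omega
  have h7 : t < 100 := by omega
  simp [separatesF, realize_ballF hX, Separates, realize_pairMemF _ hX, realize_eqF,
    Language.Formula.realize_imp, Language.Formula.realize_iff, h1, h2, h3, h4, h5, h6, h7]

theorem realize_closedUnderF (hX : ∀ x ∈ X, ∀ y ∈ x, y ∈ X) (v : ℕ → X) {g : ℕ} (hg : g < 10) :
    (closedUnderF g).Realize v ↔
      ClosedUnder (fun a => ∀ T ∈ X, ¬ Separates (v 0) a T) (v 0 : ZFSet.{u}) (v 8) (v g) := by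
  have h1 : g ≠ 10 := by omega
  have h2 : g ≠ 11 := by omega
  have h3 : g ≠ 14 := by omega
  have h7 : g < 100 := by omega
  simp [closedUnderF, realize_ballF hX, realize_bexF hX, realize_allF, realize_pairMemF _ hX,
    realize_separatesF hX, realize_memF, Language.Formula.realize_imp,
    Language.Formula.realize_not, h1, h2, h3, h7]
  constructor
  · intro h a y hay
    obtain ⟨ha, hy⟩ := mem_of_pair_mem hX (v g).2 hay
    exact h a ha y hy hay
  · intro h a _ y _ hay
    exact h a y hay

theorem realize_hasGenericsF (hX : ∀ x ∈ X, ∀ y ∈ x, y ∈ X) (v : ℕ → X) :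
    hasGenericsF.Realize v ↔ HasGenerics (v 0 : ZFSet.{u}) (v 1) (v 8) := by
  simp [hasGenericsF, HasGenerics, realize_ballF hX, realize_bexF hX, realize_pairMemF _ hX,
    Language.Formula.realize_imp, Language.Formula.realize_inf, and_left_comm]

theorem realize_coversF (hX : ∀ x ∈ X, ∀ y ∈ x, y ∈ X) (v : ℕ → X) :
    coversF.Realize v ↔ Covers (v 2 : ZFSet.{u}) (v 8) (v 9) := by
  simp [coversF, Covers, realize_ballF hX, realize_bexF hX, realize_allF, realize_pairMemF _ hX,
    realize_eqF, Language.Formula.realize_imp, Language.Formula.realize_inf]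
  intro _
  constructor
  · intro h k y y' hy hy'
    obtain ⟨hk, hyX⟩ := mem_of_pair_mem hX (v 9).2 hy
    exact h k hk y hyX y' (mem_of_pair_mem hX (v 9).2 hy').2 hy hy'
  · intro h k _ y _ y' _ hy hy'
    exact h k y y' hy hy'

theorem realize_reflectsF (hX : ∀ x ∈ X, ∀ y ∈ x, y ∈ X) (v : ℕ → X) : reflectsF.Realize v ↔
    Reflects X (v 0 : ZFSet.{u}) (v 1) (v 2) (v 3) (v 4) (v 5) (v 6) (v 7) := by
  simp [reflectsF, Reflects, realize_ballF hX, realize_allF, realize_memF, realize_separatesF hX,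
    realize_closedUnderF hX, realize_hasGenericsF hX, realize_coversF hX,
    Language.Formula.realize_imp, Language.Formula.realize_inf]
  exact fun _ => Iff.rfl

end Realize

/-! ### Closed elementary submodels of `H(χ)` -/

theorem H_transitive (χ : Cardinal.{u}) : ∀ x ∈ H χ, ∀ y ∈ x, y ∈ H χ :=
  fun _ hx _ hy => mem_H_of_mem hy hx

theorem exists_isFunc_of_card_lt {κ : Cardinal.{u}} {M a : ZFSet.{u}} (ha : a ⊆ M)
    (hc : a.card < κ) : ∃ α < κ.ord, ∃ f, ZFSet.IsFunc α.toZFSet M f ∧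
      ∀ y, y ∈ a ↔ ∃ k, ZFSet.pair k y ∈ f := by
  refine ⟨a.card.ord, ord_lt_ord.2 hc, ?_⟩
  obtain ⟨e⟩ := exists_equiv_of_card_eq (x := a.card.ord.toZFSet) (y := a)
    (by rw [Ordinal.card_toZFSet, card_ord])
  have key : ∀ (k) (hk : k ∈ a.card.ord.toZFSet) (y), (ZFSet.pair k y ∈
      ZFSet.range fun i : a.card.ord.toZFSet => ZFSet.pair i (e i)) ↔
      (e ⟨k, hk⟩ : ZFSet.{u}) = y := by
    intro k hk y
    rw [ZFSet.mem_range]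
    constructor
    · rintro ⟨i, hi⟩
      obtain ⟨rfl, rfl⟩ := ZFSet.pair_inj.1 hi
      rfl
    · rintro rfl
      exact ⟨⟨k, hk⟩, rfl⟩
  refine ⟨ZFSet.range fun i : a.card.ord.toZFSet => ZFSet.pair i (e i), ⟨fun z hz => ?_,
    fun z hz => ?_⟩, fun y => ⟨fun hy => ?_, ?_⟩⟩
  · obtain ⟨i, rfl⟩ := ZFSet.mem_range.1 hz
    exact ZFSet.pair_mem_prod.2 ⟨i.2, ha (e i).2⟩
  · exact ⟨e ⟨z, hz⟩, (key z hz _).2 rfl, fun w hw => ((key z hz w).1 hw).symm⟩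
  · refine ⟨e.symm ⟨y, hy⟩, (key _ (e.symm ⟨y, hy⟩).2 _).2 ?_⟩
    simp
  · rintro ⟨k, hk⟩
    obtain ⟨i, hi⟩ := ZFSet.mem_range.1 hk
    rw [← (ZFSet.pair_inj.1 hi).2]
    exact (e i).2

section Submodel

variable {χ κ : Cardinal.{u}} {M : ZFSet.{u}}

theorem IsElementarySubmodel.mem_of_pair_mem
    (h : IsElementarySubmodel (M : Set ZFSet.{u}) (H χ)) {a b : ZFSet.{u}}
    (hab : ZFSet.pair a b ∈ M) : a ∈ M ∧ b ∈ M := by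
  have hX := H_transitive χ
  have hH : ZFSet.pair a b ∈ H χ := h.subset hab
  have hp : ({a, b} : ZFSet.{u}) ∈ H χ := hX _ hH _ (ZFSet.mem_pair.2 (Or.inr rfl))
  have ha : a ∈ H χ := hX _ hp _ (ZFSet.mem_pair.2 (Or.inl rfl))
  have hb : b ∈ H χ := hX _ hp _ (ZFSet.mem_pair.2 (Or.inr rfl))
  constructor
  · obtain ⟨y, hyM, hy⟩ := h.exists_mem (exF 2 (pairF 0 1 2)) (fun _ => ⟨_, hH⟩) (fun _ => hab) 1
      ⟨a, ha⟩ (by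
        rw [realize_exF]
        exact ⟨⟨b, hb⟩, by simp [realize_pairF _ hX]⟩)
    obtain ⟨z, hz⟩ := (realize_exF _ _ _).1 hy
    simp only [realize_pairF _ hX (show 0 ≠ 101 by decide) (show 1 < 100 by decide)
      (show 2 < 100 by decide)] at hz
    obtain ⟨h1, -⟩ := ZFSet.pair_inj.1 (by simpa using hz)
    rwa [h1]
  · obtain ⟨y, hyM, hy⟩ := h.exists_mem (exF 1 (pairF 0 1 2)) (fun _ => ⟨_, hH⟩) (fun _ => hab) 2
      ⟨b, hb⟩ (by
        rw [realize_exF]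
        exact ⟨⟨a, ha⟩, by simp [realize_pairF _ hX]⟩)
    obtain ⟨z, hz⟩ := (realize_exF _ _ _).1 hy
    simp only [realize_pairF _ hX (show 0 ≠ 101 by decide) (show 1 < 100 by decide)
      (show 2 < 100 by decide)] at hz
    obtain ⟨-, h1⟩ := ZFSet.pair_inj.1 (by simpa using hz)
    rwa [h1]

/-- By `κ`-closure `M` contains an enumeration of `a` in fewer than `κ` steps, and `a` is definable
from it as its range. -/
theorem IsElementarySubmodel.mem_of_subset_of_card_lt
    (h : IsElementarySubmodel (M : Set ZFSet.{u}) (H χ)) (hM : IsClosedModel κ M)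
    {a : ZFSet.{u}} (ha : a ⊆ M) (hc : a.card < κ) (haH : a ∈ H χ) : a ∈ M := by
  have hX := H_transitive χ
  obtain ⟨α, hα, f, hf, hfa⟩ := exists_isFunc_of_card_lt ha hc
  have hfM : f ∈ M := hM α hα f hf
  have hfH : f ∈ H χ := h.subset hfM
  have hex : ∀ y, (∃ k ∈ H χ, ZFSet.pair k y ∈ f) ↔ ∃ k, ZFSet.pair k y ∈ f := fun y =>
    ⟨fun ⟨k, _, hk⟩ => ⟨k, hk⟩,
      fun ⟨k, hk⟩ => ⟨k, (WeakReflection.mem_of_pair_mem hX hfH hk).1, hk⟩⟩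
  have key : ∀ x : H χ, (allF 2 ((memF 2 0).iff (exF 3 (pairMemF 3 2 1)))).Realize
      (Function.update (fun _ => (⟨f, hfH⟩ : H χ)) 0 x) ↔ (x : ZFSet.{u}) = a := by
    intro x
    simp [realize_allF, realize_exF, realize_memF, realize_pairMemF _ hX,
      Language.Formula.realize_iff, hex, ← hfa]
    constructor
    · intro hx
      ext z
      exact ⟨fun hz => (hx z (hX _ x.2 z hz)).1 hz, fun hz => (hx z (hX _ haH z hz)).2 hz⟩
    · rintro rfl
      simp
  obtain ⟨y, hyM, hy⟩ := h.exists_mem _ (fun _ => (⟨f, hfH⟩ : H χ)) (fun _ => hfM) 0 ⟨a, haH⟩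
    ((key _).2 rfl)
  rwa [← (key y).1 hy]

theorem IsElementarySubmodel.closedUnder
    (h : IsElementarySubmodel (M : Set ZFSet.{u}) (H χ)) (hM : IsClosedModel κ M)
    {C G : ZFSet.{u}} (hC : C ∈ M) (hG : G ∈ M) :
    ClosedUnder (fun a => a.card < κ) C (C ∩ M) G := by
  have hX := H_transitive χ
  intro a y hay hy ha hac
  have hCH : C ∈ H χ := h.subset hC
  have haM : a ∈ M := h.mem_of_subset_of_card_lt hM (fun z hz => (ZFSet.mem_inter.1 (ha hz)).2) hac
    (mem_H_of_subset (fun z hz => (ZFSet.mem_inter.1 (ha hz)).1) hCH)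
  have key : ∀ x : H χ, (memF 3 0 ⊓ pairMemF 2 3 1).Realize (Function.update (Function.update
      (Function.update (fun _ => (⟨a, h.subset haM⟩ : H χ)) 0 ⟨C, hCH⟩) 1 ⟨G, h.subset hG⟩) 3 x) ↔
      (x : ZFSet.{u}) ∈ C ∧ ZFSet.pair a x ∈ G := by
    intro x
    simp [Language.Formula.realize_inf, realize_memF, realize_pairMemF _ hX]
  obtain ⟨z, hzM, hz⟩ := h.exists_mem _ (Function.update
      (Function.update (fun _ => (⟨a, h.subset haM⟩ : H χ)) 0 ⟨C, hCH⟩) 1 ⟨G, h.subset hG⟩)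
    (fun i => by
      by_cases h1 : i = 1
      · subst h1; simpa using hG
      · by_cases h0 : i = 0
        · subst h0; simpa using hC
        · simpa [h1, h0] using haM) 3 ⟨y, mem_H_of_mem hy hCH⟩ ((key _).2 ⟨hy, hay⟩)
  obtain ⟨h1, h2⟩ := (key z).1 hz
  exact ⟨z, ZFSet.mem_inter.2 ⟨h1, hzM⟩, h2⟩

/-- Only `C` and `R` are parameters here: the other six sets are quantified existentially, so
witnesses in `H(χ)` yield possibly different witnesses in `M`. -/
theorem IsElementarySubmodel.exists_reflects
    (h : IsElementarySubmodel (M : Set ZFSet.{u}) (H χ)) {C R K T G₀ G₁ G₂ G₃ : ZFSet.{u}}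
    (hC : C ∈ M) (hR : R ∈ M) (hK : K ∈ H χ) (hT : T ∈ H χ) (h₀ : G₀ ∈ H χ) (h₁ : G₁ ∈ H χ)
    (h₂ : G₂ ∈ H χ) (h₃ : G₃ ∈ H χ) (hr : Reflects (H χ) C R K T G₀ G₁ G₂ G₃) :
    ∃ K ∈ M, ∃ T ∈ M, ∃ G₀ ∈ M, ∃ G₁ ∈ M, ∃ G₂ ∈ M, ∃ G₃ ∈ M,
      Reflects (H χ) C R K T G₀ G₁ G₂ G₃ := by
  have hX := H_transitive χ
  let v : ℕ → (M : Set ZFSet.{u}) := fun i => if i = 0 then ⟨C, hC⟩ else ⟨R, hR⟩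
  have h1 : (exF 2 (exF 3 (exF 4 (exF 5 (exF 6 (exF 7 reflectsF)))))).Realize v := by
    rw [← h.realize_iff]
    simp only [realize_exF]
    refine ⟨⟨K, hK⟩, ⟨T, hT⟩, ⟨G₀, h₀⟩, ⟨G₁, h₁⟩, ⟨G₂, h₂⟩, ⟨G₃, h₃⟩, ?_⟩
    rw [realize_reflectsF hX]
    simpa [v] using hr
  simp only [realize_exF] at h1
  obtain ⟨K', T', g₀, g₁, g₂, g₃, h2⟩ := h1
  rw [← h.realize_iff, realize_reflectsF hX] at h2
  exact ⟨K', K'.2, T', T'.2, g₀, g₀.2, g₁, g₁.2, g₂, g₂.2, g₃, g₃.2, by simpa [v] using h2⟩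

end Submodel

/-! ### Restriction of the order to a closed set, and its strong properness -/

namespace Forcing

/-- The restriction of a forcing notion to the conditions that belong to `N`. -/
def restrict (P : Forcing.{u}) (N : ZFSet.{u}) : Forcing.{u} where
  carrier := P.carrier ∩ N
  rel := P.rel ∩ ZFSet.prod (P.carrier ∩ N) (P.carrier ∩ N)
  rel_subset := fun _ hz => (ZFSet.mem_inter.1 hz).2
  refl := fun p hp => ZFSet.mem_inter.2
    ⟨P.refl p (ZFSet.mem_inter.1 hp).1, ZFSet.pair_mem_prod.2 ⟨hp, hp⟩⟩
  trans := fun p q r hpq hqr => by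
    rw [ZFSet.mem_inter, ZFSet.pair_mem_prod] at *
    exact ⟨P.trans p q r hpq.1 hqr.1, hpq.2.1, hqr.2.2⟩

theorem mem_carrier_restrict {P : Forcing.{u}} {N p : ZFSet.{u}} :
    p ∈ (P.restrict N).carrier ↔ p ∈ P.carrier ∧ p ∈ N :=
  ZFSet.mem_inter

theorem restrict_le {P : Forcing.{u}} {N p q : ZFSet.{u}} : (P.restrict N).le p q ↔
    P.le p q ∧ p ∈ (P.restrict N).carrier ∧ q ∈ (P.restrict N).carrier := by
  simp only [le, restrict, ZFSet.mem_inter, ZFSet.pair_mem_prod]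

theorem le.right_mem {P : Forcing.{u}} {p q : ZFSet.{u}} (h : P.le p q) : q ∈ P.carrier :=
  (ZFSet.pair_mem_prod.1 (P.rel_subset h)).2

theorem restrict_isSuborder (P : Forcing.{u}) (N : ZFSet.{u}) : (P.restrict N).IsSuborder P :=
  ⟨fun _ hp => (mem_carrier_restrict.1 hp).1,
    fun _ hp _ hq => restrict_le.trans ⟨fun h => h.1, fun h => ⟨h, hp, hq⟩⟩⟩

end Forcing

/-- `N` is closed under the operations on `P` and `H(θ)` needed for reflection. -/
structure IsReflectingSet (κ θ : Cardinal.{u}) (P : Forcing.{u}) (Sk : ZFSet.{u} → ZFSet.{u})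
    (N : ZFSet.{u}) : Prop where
  mem_H : ∀ x ∈ N, x ∈ H θ
  mem_of_subset : ∀ b ⊆ N, b.card ≤ κ → b ∈ N
  skolem_mem : ∀ x ∈ N, Sk x ∈ N
  exists_glb : ∀ X ⊆ N, X.card < κ → (∃ g, P.IsGreatestLowerBound X g) →
    ∃ g ∈ N, P.IsGreatestLowerBound X g
  exists_generic : ∀ M ∈ N, ∀ p ∈ N, (∃ q, P.le q p ∧ P.IsStronglyGeneric M q) →
    ∃ q ∈ N, P.le q p ∧ P.IsStronglyGeneric M q

section Reflecting

variable {κ θ : Cardinal.{u}} {P : Forcing.{u}} {Sk : ZFSet.{u} → ZFSet.{u}} {N : ZFSet.{u}}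

/-- A compatible pair has a greatest lower bound, and one can be found in `N`; so compatibility
passes from `P` to the restriction. -/
theorem IsReflectingSet.exists_le (hN : IsReflectingSet κ θ P Sk N) (hκ : ℵ₀ ≤ κ)
    (hlat : P.IsLattice κ) {p q : ZFSet.{u}} (hp : p ∈ N) (hq : q ∈ N)
    (hpq : P.Compatible p q) : ∃ r ∈ (P.restrict N).carrier, P.le r p ∧ P.le r q := by
  have hX : ∀ {x}, x ∈ ({p, q} : ZFSet.{u}) ↔ x = p ∨ x = q := ZFSet.mem_pair
  obtain ⟨r, hr, hrp, hrq⟩ := hpq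
  have hc := card_upair_lt p q hκ
  obtain ⟨g, hgN, hg, hgX, -⟩ := hN.exists_glb {p, q}
    (fun x hx => by rcases hX.1 hx with rfl | rfl <;> assumption) hc
    (hlat {p, q} (fun x hx => by
      rcases hX.1 hx with rfl | rfl
      · exact hrp.right_mem
      · exact hrq.right_mem) hc fun x hx y hy =>
        ⟨r, hr, by rcases hX.1 hx with rfl | rfl <;> assumption,
          by rcases hX.1 hy with rfl | rfl <;> assumption⟩)
  exact ⟨g, Forcing.mem_carrier_restrict.2 ⟨hg, hgN⟩, hgX p (hX.2 (Or.inl rfl)),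
    hgX q (hX.2 (Or.inr rfl))⟩

theorem IsReflectingSet.isLattice_restrict (hN : IsReflectingSet κ θ P Sk N)
    (hlat : P.IsLattice κ) : (P.restrict N).IsLattice κ := by
  intro X hX hXc hcomp
  have hX' : ∀ x ∈ X, x ∈ P.carrier ∧ x ∈ N := fun x hx => Forcing.mem_carrier_restrict.1 (hX hx)
  obtain ⟨g, hgN, hg, hgX, hgg⟩ := hN.exists_glb X (fun x hx => (hX' x hx).2) hXc
    (hlat X (fun x hx => (hX' x hx).1) hXc fun p hp q hq => by
      obtain ⟨r, hr, h1, h2⟩ := hcomp p hp q hq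
      exact ⟨r, (Forcing.mem_carrier_restrict.1 hr).1, (Forcing.restrict_le.1 h1).1,
        (Forcing.restrict_le.1 h2).1⟩)
  have hgC : g ∈ (P.restrict N).carrier := Forcing.mem_carrier_restrict.2 ⟨hg, hgN⟩
  refine ⟨g, hgC, fun p hp => Forcing.restrict_le.2 ⟨hgX p hp, hgC, hX hp⟩, fun r hr hrX => ?_⟩
  exact Forcing.restrict_le.2 ⟨hgg r (Forcing.mem_carrier_restrict.1 hr).1 fun p hp =>
    (Forcing.restrict_le.1 (hrX p hp)).1, hr, hgC⟩

theorem ContainsSmallSubsets.toZFSet_mem {M : ZFSet.{u}} (hM : ContainsSmallSubsets κ M)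
    (α : Ordinal.{u}) (hα : α < κ.ord) : α.toZFSet ∈ M := by
  induction α using WellFoundedLT.induction with
  | _ α ih =>
    refine hM _ (fun z hz => ?_) (by rw [Ordinal.card_toZFSet]; exact lt_ord.1 hα)
    obtain ⟨β, hβ, rfl⟩ := Ordinal.mem_toZFSet_iff.1 hz
    exact ih β hβ (hβ.trans hα)

theorem ContainsSmallSubsets.isClosedModel {M : ZFSet.{u}} (hM : ContainsSmallSubsets κ M)
    (hκ : ℵ₀ ≤ κ) : IsClosedModel κ M := by
  intro α hα f hf
  have hα' : α.toZFSet ⊆ M := fun z hz => by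
    obtain ⟨β, hβ, rfl⟩ := Ordinal.mem_toZFSet_iff.1 hz
    exact hM.toZFSet_mem β (hβ.trans hα)
  refine hM f (fun z hz => ?_) ?_
  · obtain ⟨a, ha, b, hb, rfl⟩ := ZFSet.mem_prod.1 (hf.1 hz)
    exact hM.pair_mem hκ (hα' ha) hb
  · choose! g hg hg' using hf.2
    refine lt_of_le_of_lt (ZFSet.card_mono (y := img (fun k => ZFSet.pair k (g k)) α.toZFSet)
      fun z hz => ?_) ((card_img_le _ _).trans_lt
        (by rw [Ordinal.card_toZFSet]; exact lt_ord.1 hα))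
    obtain ⟨a, ha, b, hb, rfl⟩ := ZFSet.mem_prod.1 (hf.1 hz)
    exact mem_img.2 ⟨a, ha, by rw [hg' a ha b hz]⟩

/-- If `Sk` is a Skolem function for `H(θ)` with value the code of `P` at `∅`, then sets of
conditions that correspond to elementary submodels of `H(θ)` have strongly generic conditions. -/
theorem IsReflectingSet.hasGenerics (hN : IsReflectingSet κ θ P Sk N) (hκ : ℵ₀ ≤ κ)
    (hlat : P.IsLattice κ) (hprop : P.IsStronglyProper κ) (hSk₀ : Sk ∅ = P.code)
    (hSk : ∀ M : ZFSet.{u}, (∀ x ∈ M, x ∈ H θ) → ContainsSmallSubsets κ M →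
      (∀ x ∈ M, Sk x ∈ M) → IsElementarySubmodel (M : Set ZFSet.{u}) (H θ))
    {e : ZFSet.{u} → ZFSet.{u}} (hinj : ∀ a ∈ N, ∀ b ∈ N, e a = e b → a = b)
    {A : ZFSet.{u}} (hA : A ⊆ (P.restrict N).carrier) (hAc : A.card ≤ κ)
    (h₀ : ∀ b ⊆ N, b.card < κ → (∀ x ∈ b, e x ∈ A) → e b ∈ A)
    (h₁ : ∀ x ∈ N, e x ∈ A → e (Sk x) ∈ A) (h₂ : ∀ x ∈ A, e x ∈ A)
    (h₃ : ∀ x ∈ (P.restrict N).carrier, e x ∈ A → x ∈ A) :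
    HasGenerics (P.restrict N).carrier (P.restrict N).rel A := by
  -- Pulling `A` back along the copying map `e` gives the model; `h₂` and `h₃` say that its
  -- conditions are exactly the elements of `A`.
  set M := N.sep fun x => e x ∈ A
  have hMmem : ∀ {x}, x ∈ M ↔ x ∈ N ∧ e x ∈ A := ZFSet.mem_sep
  have hMN : M ⊆ N := ZFSet.sep_subset
  have hMs : ContainsSmallSubsets κ M := fun b hb hbc => by
    have hbN : b ⊆ N := fun x hx => hMN (hb hx)
    exact hMmem.2 ⟨hN.mem_of_subset b hbN hbc.le,
      h₀ b hbN hbc fun x hx => (hMmem.1 (hb hx)).2⟩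
  have hMS : ∀ x ∈ M, Sk x ∈ M := fun x hx =>
    hMmem.2 ⟨hN.skolem_mem x (hMN hx), h₁ x (hMN hx) (hMmem.1 hx).2⟩
  have hMe := hSk M (fun x hx => hN.mem_H x (hMN hx)) hMs hMS
  have hcode : P.code ∈ M := hSk₀ ▸ hMS ∅ (hMs.empty_mem hκ)
  have hMc : M.card ≤ κ := (card_le_of_injOn e (fun x hx => (hMmem.1 hx).2)
    fun a ha b hb => hinj a (hMN ha) b (hMN hb)).trans hAc
  have hMc' : M.card = κ := by
    refine le_antisymm hMc ?_
    have : κ.ord.toZFSet ⊆ M := fun z hz => by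
      obtain ⟨β, hβ, rfl⟩ := Ordinal.mem_toZFSet_iff.1 hz
      exact hMs.toZFSet_mem β hβ
    have h := ZFSet.card_mono this
    rwa [Ordinal.card_toZFSet, card_ord] at h
  -- Membership of the model itself in `N` allows a strongly generic condition to be chosen in `N`.
  have hMN' : M ∈ N := hN.mem_of_subset M hMN hMc
  intro p hp
  have hpC := Forcing.mem_carrier_restrict.1 (hA hp)
  obtain ⟨q, hqN, hqp, hqP, hq⟩ := hN.exists_generic M hMN' p hpC.2
    (hprop θ M ⟨hMs.isClosedModel hκ, hMc'⟩ hMe hcode p hpC.1 (hMmem.2 ⟨hpC.2, h₂ p hp⟩))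
  have hqC : q ∈ (P.restrict N).carrier := Forcing.mem_carrier_restrict.2 ⟨hqP, hqN⟩
  refine ⟨q, hqC, Forcing.restrict_le.2 ⟨hqp, hqC, hA hp⟩, fun q' hq' hq'q => ?_⟩
  have hq'C := Forcing.mem_carrier_restrict.1 hq'
  obtain ⟨π, hπP, hπM, hπ⟩ := hq q' hq'C.1 (Forcing.restrict_le.1 hq'q).1
  refine ⟨π, h₃ π (Forcing.mem_carrier_restrict.2 ⟨hπP, hMN hπM⟩) (hMmem.1 hπM).2,
    fun r hr hrπ => ?_⟩
  have hrC := Forcing.mem_carrier_restrict.1 (hA hr)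
  obtain ⟨s, hs, hsr, hsq⟩ := hN.exists_le hκ hlat hrC.2 hq'C.2
    (hπ r hrC.1 (hMmem.2 ⟨hrC.2, h₂ r hr⟩) (Forcing.restrict_le.1 hrπ).1)
  exact ⟨s, hs, Forcing.restrict_le.2 ⟨hsr, hs, hA hr⟩, Forcing.restrict_le.2 ⟨hsq, hs, hq'⟩⟩

/-- The set of pairs `(α b, β b)` in `S × C`, for `b` in the class `dom`. -/
noncomputable def pairsOf (S C : ZFSet.{u}) (dom : ZFSet.{u} → Prop)
    (α β : ZFSet.{u} → ZFSet.{u}) : ZFSet.{u} :=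
  (ZFSet.prod S C).sep fun z => ∃ b, dom b ∧ z = ZFSet.pair (α b) (β b)

/-- Injectivity of `α` on `dom` makes the relation the graph of a partial function, so the element
of `A` related to `α b` can only be `β b`. -/
theorem ClosedUnder.apply_mem {C A : ZFSet.{u}} {dom : ZFSet.{u} → Prop}
    {α β : ZFSet.{u} → ZFSet.{u}} (hA : A ⊆ C)
    (h : ClosedUnder (fun a => a.card < κ) C A (pairsOf (subsetsLE κ C) C dom α β))
    (hα : ∀ b b', dom b → dom b' → α b = α b' → b = b') {b : ZFSet.{u}} (hb : dom b)
    (hbA : α b ⊆ A) (hbc : (α b).card < κ) (hβ : β b ∈ C) : β b ∈ A := by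
  obtain ⟨y, hyA, hy⟩ := h (α b) (β b) (ZFSet.mem_sep.2 ⟨ZFSet.pair_mem_prod.2
    ⟨mem_subsetsLE.2 ⟨fun z hz => hA (hbA hz), hbc.le⟩, hβ⟩, b, hb, rfl⟩) hβ hbA hbc
  obtain ⟨-, b', hb', he⟩ := ZFSet.mem_sep.1 hy
  obtain ⟨h1, h2⟩ := ZFSet.pair_inj.1 he
  rw [hα b b' hb hb' h1, ← h2]
  exact hyA

theorem Covers.card_le {K A h : ZFSet.{u}} (hc : Covers K A h) : A.card ≤ K.card := by
  choose! g hgK hg using hc.1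
  exact card_le_of_injOn g hgK fun a ha b hb hab => hc.2 (g a) a b (hg a ha) (hab ▸ hg b hb)

theorem exists_covers {K A : ZFSet.{u}} (h : A.card ≤ K.card) :
    ∃ f ⊆ ZFSet.prod K A, Covers K A f := by
  rw [← lift_le.{u + 1}, lift_card, lift_card] at h
  obtain ⟨g⟩ := h
  refine ⟨ZFSet.range fun y : A => ZFSet.pair (g y) y, fun z hz => ?_, fun y hy => ?_,
    fun k y y' hy hy' => ?_⟩
  · obtain ⟨y, rfl⟩ := ZFSet.mem_range.1 hz
    exact ZFSet.pair_mem_prod.2 ⟨(g y).2, y.2⟩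
  · exact ⟨g ⟨y, hy⟩, (g _).2, ZFSet.mem_range.2 ⟨⟨y, hy⟩, rfl⟩⟩
  · obtain ⟨a, ha⟩ := ZFSet.mem_range.1 hy
    obtain ⟨b, hb⟩ := ZFSet.mem_range.1 hy'
    obtain ⟨ha1, rfl⟩ := ZFSet.pair_inj.1 ha
    obtain ⟨hb1, rfl⟩ := ZFSet.pair_inj.1 hb
    rw [g.injective (Subtype.ext (ha1.trans hb1.symm))]

theorem closedUnder_congr {C A G : ZFSet.{u}} {s s' : ZFSet.{u} → Prop}
    (h : ∀ a ⊆ A, s a ↔ s' a) : ClosedUnder s C A G ↔ ClosedUnder s' C A G := by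
  refine forall₅_congr fun a y _ _ ha => ?_
  rw [h a ha]

/-- The copy of `N` on `C` witnesses `Reflects` in `H(χ)`; elementarity moves the witnesses into
`M`, where they are applied to `C ∩ M`. -/
theorem IsReflectingSet.isStronglyProper_restrict (hN : IsReflectingSet κ θ P Sk N)
    (hreg : κ.IsRegular) (hκ : κ ^< κ = κ) (hlat : P.IsLattice κ) (hprop : P.IsStronglyProper κ)
    (hSk₀ : Sk ∅ = P.code)
    (hSk : ∀ M : ZFSet.{u}, (∀ x ∈ M, x ∈ H θ) → ContainsSmallSubsets κ M →
      (∀ x ∈ M, Sk x ∈ M) → IsElementarySubmodel (M : Set ZFSet.{u}) (H θ))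
    (hNc : N.card ≤ 2 ^ κ) (hC : (P.restrict N).carrier.card = 2 ^ κ) :
    (P.restrict N).IsStronglyProper κ := by
  rintro χ M ⟨hMc, hMκ⟩ hM hcode
  set C := (P.restrict N).carrier
  set R := (P.restrict N).rel
  obtain ⟨hCM, hRM⟩ := hM.mem_of_pair_mem hcode
  have hCH : C ∈ H χ := hM.subset hCM
  have hχ : 2 ^ κ < χ := hC ▸ card_lt_of_mem_H hCH
  have hχ' : ℵ₀ < χ := (hreg.1.trans_lt (cantor κ)).trans hχ
  have hsmall : ∀ A ⊆ C, ∀ a ⊆ A, (∀ T ∈ H χ, ¬ Separates C a T) ↔ a.card < κ :=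
    fun A hA a ha => card_lt_iff_forall_not_separates hreg hκ hχ hC hCH
      (mem_H_of_subset (fun z hz => hA (ha hz)) hCH)
  have hCN : C ⊆ N := fun x hx => (Forcing.mem_carrier_restrict.1 hx).2
  -- The copying map exists because `|N| ≤ 2 ^ κ = |C|`.
  obtain ⟨e, heC, heinj⟩ : ∃ e : ZFSet.{u} → ZFSet.{u}, (∀ x ∈ N, e x ∈ C) ∧
      ∀ a ∈ N, ∀ b ∈ N, e a = e b → a = b := by
    have hle := hNc.trans hC.ge
    rw [← lift_le.{u + 1}, lift_card, lift_card] at hle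
    obtain ⟨g⟩ := hle
    classical
    refine ⟨fun x => if hx : x ∈ N then g ⟨x, hx⟩ else ∅, fun x hx => ?_, fun a ha b hb hab => ?_⟩
    · simp only [dif_pos hx]; exact (g _).2
    · simp only [dif_pos ha, dif_pos hb] at hab
      exact congrArg Subtype.val (g.injective (Subtype.ext hab))
  obtain ⟨K, hKC, hKc⟩ := exists_subset_card_eq (x := C) (c := κ) (hC ▸ (cantor κ).le)
  obtain ⟨T, hT, hsep⟩ := exists_separates (C := C) (K := K) (by rw [hC, hKc])
  have hKH : K ∈ H χ := mem_H_of_subset hKC hCH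
  have hpairs : ∀ dom α β, pairsOf (subsetsLE κ C) C dom α β ∈ H χ := fun dom α β =>
    mem_H_of_subset ZFSet.sep_subset
      (prod_mem_H hχ' (subsetsLE_mem_H hreg.1 hχ hCH hC.le) hCH)
  have hsingle : ∀ x : ZFSet.{u}, ({x} : ZFSet.{u}).card < κ := fun x => by
    rw [ZFSet.card_singleton]; exact one_lt_aleph0.trans_le hreg.1
  -- The relations code, in order: forming subsets of `N` of size less than `κ`, the Skolem
  -- function, the passage from a condition to its copy, and back.
  have hrefl : Reflects (H χ) C R K T
      (pairsOf (subsetsLE κ C) C (fun b => b ⊆ N ∧ b.card < κ) (img e) e)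
      (pairsOf (subsetsLE κ C) C (· ∈ N) (fun x => {e x}) fun x => e (Sk x))
      (pairsOf (subsetsLE κ C) C (· ∈ C) (fun x => {x}) e)
      (pairsOf (subsetsLE κ C) C (· ∈ C) (fun x => {e x}) id) := by
    refine ⟨hsep, fun A _ h _ hA hcov h₀ h₁ h₂ h₃ => ?_⟩
    rw [closedUnder_congr (hsmall A hA)] at h₀ h₁ h₂ h₃
    refine hN.hasGenerics hreg.1 hlat hprop hSk₀ hSk heinj hA (hKc ▸ hcov.card_le) ?_ ?_ ?_ ?_
    · intro b hbN hbc hbA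
      refine h₀.apply_mem hA (fun b b' hb hb' hbb' => ?_) ⟨hbN, hbc⟩ (fun y hy => ?_)
        ((card_img_le _ _).trans_lt hbc) (heC b (hN.mem_of_subset b hbN hbc.le))
      · have key : ∀ c d : ZFSet.{u}, c ⊆ N → d ⊆ N → img e c = img e d → c ⊆ d := by
          intro c d hc hd hcd x hx
          obtain ⟨y, hy, hxy⟩ := mem_img.1 (hcd ▸ mem_img.2 ⟨x, hx, rfl⟩ : e x ∈ img e d)
          rwa [heinj x (hc hx) y (hd hy) hxy.symm]
        exact ZFSet.ext fun x => ⟨fun hx => key b b' hb.1 hb'.1 hbb' hx,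
          fun hx => key b' b hb'.1 hb.1 hbb'.symm hx⟩
      · obtain ⟨x, hx, rfl⟩ := mem_img.1 hy
        exact hbA x hx
    · intro x hx hxA
      refine h₁.apply_mem hA (fun b b' hb hb' hbb' => heinj b hb b' hb'
        (ZFSet.singleton_injective hbb')) hx (fun y hy => ?_) (hsingle _)
        (heC _ (hN.skolem_mem x hx))
      rwa [ZFSet.mem_singleton.1 hy]
    · intro x hx
      refine h₂.apply_mem hA (fun b b' _ _ hbb' => ZFSet.singleton_injective hbb') (hA hx)
        (fun y hy => ?_) (hsingle _) (heC _ (hCN (hA hx)))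
      rwa [ZFSet.mem_singleton.1 hy]
    · intro x hx hxA
      refine h₃.apply_mem hA (fun b b' hb hb' hbb' => heinj b (hCN hb) b' (hCN hb')
        (ZFSet.singleton_injective hbb')) hx (fun y hy => ?_) (hsingle _) hx
      rwa [ZFSet.mem_singleton.1 hy]
  obtain ⟨K', hK', T', -, g₀, hg₀, g₁, hg₁, g₂, hg₂, g₃, hg₃, hsep', hgen⟩ :=
    hM.exists_reflects hCM hRM hKH (mem_H_of_subset hT (prod_mem_H hχ' hKH hCH)) (hpairs _ _ _)
      (hpairs _ _ _) (hpairs _ _ _) (hpairs _ _ _) hrefl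
  have hAC : C ∩ M ⊆ C := fun x hx => (ZFSet.mem_inter.1 hx).1
  -- The new `K'` need not have size `κ`, but separation forces size at least `κ`, enough to cover
  -- `C ∩ M`.
  have hAK : (C ∩ M).card ≤ K'.card :=
    ((ZFSet.card_mono fun x hx => (ZFSet.mem_inter.1 hx).2).trans hMκ.le).trans
      (le_card_of_separates hreg hκ hC hsep')
  obtain ⟨f, hf, hcov⟩ := exists_covers hAK
  have hAH : C ∩ M ∈ H χ := mem_H_of_subset hAC hCH
  have hclosed : ∀ g ∈ M, ClosedUnder (fun a => ∀ T ∈ H χ, ¬ Separates C a T) C (C ∩ M) g :=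
    fun g hg => (closedUnder_congr (hsmall _ hAC)).2 (hM.closedUnder hMc hCM hg)
  have hfin := hgen _ hAH f (mem_H_of_subset hf (prod_mem_H hχ' (hM.subset hK') hAH)) hAC hcov
    (hclosed _ hg₀) (hclosed _ hg₁) (hclosed _ hg₂) (hclosed _ hg₃)
  intro p hp hpM
  obtain ⟨q, hq, hqp, hqg⟩ := hfin p (ZFSet.mem_inter.2 ⟨hp, hpM⟩)
  refine ⟨q, hqp, hq, fun q' hq' hq'q => ?_⟩
  obtain ⟨π, hπ, hπg⟩ := hqg q' hq' hq'q
  obtain ⟨hπC, hπM⟩ := ZFSet.mem_inter.1 hπ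
  refine ⟨π, hπC, hπM, fun r hr hrM hrπ => ?_⟩
  exact hπg r (ZFSet.mem_inter.2 ⟨hr, hrM⟩) hrπ

end Reflecting

/-- All required operations are packed into one operation on sets of size at most `κ`, to which
`exists_closed_under` applies. -/
theorem exists_isReflectingSet {κ μ : Cardinal.{u}} (hκ : ℵ₀ ≤ κ) (hμ : κ ≤ μ) {P : Forcing.{u}}
    (hP : P.code ∈ H (Order.succ μ)) {Sk : ZFSet.{u} → ZFSet.{u}}
    (hSk : ∀ z, Sk z ∈ H (Order.succ μ)) (Ψ : ZFSet.{u} → ZFSet.{u})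
    (hΨc : ∀ x, (Ψ x).card ≤ 2 ^ κ) (hΨP : ∀ x, Ψ x ⊆ P.carrier) :
    ∃ N : ZFSet.{u}, N.card ≤ 2 ^ κ ∧ IsReflectingSet κ (Order.succ μ) P Sk N ∧
      ∀ x ∈ N, Ψ x ⊆ N := by
  classical
  have h2 : ℵ₀ ≤ (2 : Cardinal.{u}) ^ κ := hκ.trans (cantor κ).le
  have hPH : ∀ p ∈ P.carrier, p ∈ H (Order.succ μ) := fun p hp =>
    mem_H_of_mem hp (mem_of_pair_mem (x := {P.code})
      (X := H (Order.succ μ)) (H_transitive _) (mem_H_succ_of_card_le (hκ.trans hμ)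
      (fun x hx => by rwa [ZFSet.mem_singleton.1 hx])
      (by rw [ZFSet.card_singleton]; exact one_le_aleph0.trans (hκ.trans hμ)))
      (ZFSet.mem_singleton.2 rfl)).1
  have hglb : ∀ X, ∃ g, (∃ g, P.IsGreatestLowerBound X g) → P.IsGreatestLowerBound X g :=
      fun X => by
    by_cases h : ∃ g, P.IsGreatestLowerBound X g
    · exact h.imp fun g hg _ => hg
    · exact ⟨∅, fun h' => absurd h' h⟩
  choose glb hglb using hglb
  have hgen : ∀ M p, ∃ q, (∃ q, P.le q p ∧ P.IsStronglyGeneric M q) →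
      P.le q p ∧ P.IsStronglyGeneric M q := fun M p => by
    by_cases h : ∃ q, P.le q p ∧ P.IsStronglyGeneric M q
    · exact h.imp fun g hg _ => hg
    · exact ⟨∅, fun h' => absurd h' h⟩
  choose gen hgen using hgen
  have hgen' : ∀ x, ∃ q, ∀ M p, x = ZFSet.pair M p → q = gen M p := fun x => by
    by_cases h : ∃ M p, x = ZFSet.pair M p
    · obtain ⟨M, p, rfl⟩ := h
      refine ⟨gen M p, fun M' p' he => ?_⟩
      obtain ⟨rfl, rfl⟩ := ZFSet.pair_inj.1 he
      rfl
    · exact ⟨∅, fun M p he => absurd ⟨M, p, he⟩ h⟩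
  choose gen' hgen' using hgen'
  -- Unary operations act on `⋃ b`, so that `b = {x}` returns their value at `x`.
  let Φ : ZFSet.{u} → ZFSet.{u} := fun b =>
    ({b, Sk (ZFSet.sUnion b)} ∪ {glb b, gen' (ZFSet.sUnion b)}) ∪ Ψ (ZFSet.sUnion b)
  obtain ⟨N₀, hN₀c, hN₀⟩ := exists_closed_under hκ Φ fun b =>
    card_union_le_of_le h2 (card_union_le_of_le h2 (card_upair_lt _ _ h2).le
      (card_upair_lt _ _ h2).le) (hΨc _)
  -- The choice functions are unconstrained where nothing suitable exists, so values outside `H(μ⁺)`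
  -- are discarded.
  set N := N₀.sep (· ∈ H (Order.succ μ))
  have hN : ∀ {x}, x ∈ N ↔ x ∈ N₀ ∧ x ∈ H (Order.succ μ) := ZFSet.mem_sep
  have hΦ : ∀ b ⊆ N, b.card ≤ κ → ∀ y ∈ Φ b, y ∈ H (Order.succ μ) → y ∈ N :=
    fun b hb hbc y hy hyH => hN.2 ⟨hN₀ b (fun x hx => (hN.1 (hb hx)).1) hbc hy, hyH⟩
  have hΦ₁ : ∀ x ∈ N, ∀ y ∈ Φ {x}, y ∈ H (Order.succ μ) → y ∈ N := fun x hx =>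
    hΦ {x} (fun z hz => by rwa [ZFSet.mem_singleton.1 hz])
      (by rw [ZFSet.card_singleton]; exact one_le_aleph0.trans hκ)
  have hsub : ∀ b ⊆ N, b.card ≤ κ → b ∈ N := fun b hb hbc =>
    hΦ b hb hbc b (by simp [Φ])
      (mem_H_succ_of_card_le (hκ.trans hμ) (fun x hx => (hN.1 (hb hx)).2) (hbc.trans hμ))
  have hsmall : ContainsSmallSubsets κ N := fun b hb hbc => hsub b hb hbc.le
  refine ⟨N, (ZFSet.card_mono ZFSet.sep_subset).trans hN₀c, ⟨fun x hx => (hN.1 hx).2, hsub,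
    fun x hx => hΦ₁ x hx _ (by simp [Φ]) (hSk x), fun X hX hXc hex => ?_,
    fun M hM p hp hex => ?_⟩, fun x hx y hy => ?_⟩
  · have h := hglb X hex
    exact ⟨glb X, hΦ X hX hXc.le _ (by simp [Φ]) (hPH _ h.1), h⟩
  · have h := hgen M p hex
    refine ⟨gen M p, hΦ₁ _ (hsmall.pair_mem hκ hM hp) _ ?_ (hPH _ h.2.1), h⟩
    simp [Φ, hgen' _ M p rfl]
  · exact hΦ₁ x hx y (by simp [Φ, hy]) (hPH y (hΨP x hy))

/-! ### Generic filters -/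

/-- The upward closure in `P` of a generic filter on the restriction is generic. -/
theorem exists_genericFilter_of_restrict {ι : Type*} {P : Forcing.{u}} {N : ZFSet.{u}}
    {D : ι → ZFSet.{u}} (hG : ∃ G, (P.restrict N).IsGenericFilter (fun i => D i ∩ N) G) :
    ∃ G, P.IsGenericFilter D G := by
  obtain ⟨G, ⟨hGC, ⟨p₀, hp₀⟩, hup, hdir⟩, hmeet⟩ := hG
  have hGP : ∀ p ∈ G, p ∈ P.carrier := fun p hp => (Forcing.mem_carrier_restrict.1 (hGC hp)).1
  have hmem : ∀ {q}, q ∈ P.carrier.sep (fun q => ∃ p ∈ G, P.le p q) ↔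
      q ∈ P.carrier ∧ ∃ p ∈ G, P.le p q := ZFSet.mem_sep
  have hself : ∀ p ∈ G, p ∈ P.carrier.sep (fun q => ∃ p ∈ G, P.le p q) := fun p hp =>
    hmem.2 ⟨hGP p hp, p, hp, P.refl p (hGP p hp)⟩
  refine ⟨P.carrier.sep fun q => ∃ p ∈ G, P.le p q, ⟨ZFSet.sep_subset, ⟨p₀, hself p₀ hp₀⟩,
    fun p hp q hq hpq => ?_, fun p hp q hq => ?_⟩, fun i => ?_⟩
  · obtain ⟨-, r, hr, hrp⟩ := hmem.1 hp
    exact hmem.2 ⟨hq, r, hr, P.trans r p q hrp hpq⟩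
  · obtain ⟨-, r, hr, hrp⟩ := hmem.1 hp
    obtain ⟨-, s, hs, hsq⟩ := hmem.1 hq
    obtain ⟨t, ht, htr, hts⟩ := hdir r hr s hs
    exact ⟨t, hself t ht, P.trans t r p (Forcing.restrict_le.1 htr).1 hrp,
      P.trans t s q (Forcing.restrict_le.1 hts).1 hsq⟩
  · obtain ⟨p, hp, hpD⟩ := hmeet i
    exact ⟨p, hself p hp, (ZFSet.mem_inter.1 hpD).1⟩

theorem isGenericFilter_restrict {ι : Type*} [Nonempty ι] {P : Forcing.{u}} {N G : ZFSet.{u}}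
    {D : ι → ZFSet.{u}} (hG : P.IsGenericFilter D G) (hmeet : ∀ i, ∃ p ∈ G, p ∈ D i ∧ p ∈ N)
    (hdir : ∀ p ∈ G, p ∈ N → ∀ q ∈ G, q ∈ N → ∃ r ∈ G, r ∈ N ∧ P.le r p ∧ P.le r q) :
    (P.restrict N).IsGenericFilter (fun i => D i ∩ N) (G ∩ N) := by
  obtain ⟨⟨hGP, -, hup, -⟩, -⟩ := hG
  have hC : ∀ p ∈ G ∩ N, p ∈ (P.restrict N).carrier := fun p hp => by
    rw [ZFSet.mem_inter] at hp
    exact Forcing.mem_carrier_restrict.2 ⟨hGP hp.1, hp.2⟩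
  refine ⟨⟨hC, ?_, fun p hp q hq hpq => ?_, fun p hp q hq => ?_⟩, fun i => ?_⟩
  · obtain ⟨p, hp, -, hpN⟩ := hmeet (Classical.arbitrary ι)
    exact ⟨p, ZFSet.mem_inter.2 ⟨hp, hpN⟩⟩
  · rw [ZFSet.mem_inter] at hp ⊢
    rw [Forcing.mem_carrier_restrict] at hq
    exact ⟨hup p hp.1 q hq.1 (Forcing.restrict_le.1 hpq).1, hq.2⟩
  · obtain ⟨hp1, hp2⟩ := ZFSet.mem_inter.1 hp
    obtain ⟨hq1, hq2⟩ := ZFSet.mem_inter.1 hq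
    obtain ⟨r, hr, hrN, hrp, hrq⟩ := hdir p hp1 hp2 q hq1 hq2
    have hr' : r ∈ G ∩ N := ZFSet.mem_inter.2 ⟨hr, hrN⟩
    exact ⟨r, hr', Forcing.restrict_le.2 ⟨hrp, hC r hr', hC p hp⟩,
      Forcing.restrict_le.2 ⟨hrq, hC r hr', hC q hq⟩⟩
  · obtain ⟨p, hp, hpD, hpN⟩ := hmeet i
    exact ⟨p, ZFSet.mem_inter.2 ⟨hp, hpN⟩, ZFSet.mem_inter.2 ⟨hpD, hpN⟩⟩

/-- A generic filter, if there is one, comes with functions choosing its elements in the given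
sets and common extensions of its elements. -/
theorem exists_filter_choice {ι : Type*} (P : Forcing.{u}) (D : ι → ZFSet.{u}) :
    ∃ (G : ZFSet.{u}) (g : ι → ZFSet.{u}) (j : ZFSet.{u} → ZFSet.{u}),
      (∃ G, P.IsGenericFilter D G) → P.IsGenericFilter D G ∧ (∀ i, g i ∈ G ∧ g i ∈ D i) ∧
        ∀ p ∈ G, ∀ q ∈ G, j (ZFSet.pair p q) ∈ G ∧ P.le (j (ZFSet.pair p q)) p ∧
          P.le (j (ZFSet.pair p q)) q := by
  by_cases h : ∃ G, P.IsGenericFilter D G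
  · obtain ⟨G, hG⟩ := h
    choose g hg using hG.2
    have hj : ∀ x, (∃ p ∈ G, ∃ q ∈ G, x = ZFSet.pair p q) →
        ∃ r ∈ G, ∀ p q, x = ZFSet.pair p q → P.le r p ∧ P.le r q := by
      rintro x ⟨p, hp, q, hq, rfl⟩
      obtain ⟨r, hr, hrpq⟩ := hG.1.2.2.2 p hp q hq
      refine ⟨r, hr, fun p' q' he => ?_⟩
      obtain ⟨rfl, rfl⟩ := ZFSet.pair_inj.1 he
      exact hrpq
    choose! j hjG hj using hj
    exact ⟨G, g, j, fun _ => ⟨hG, hg, fun p hp q hq => ⟨hjG _ ⟨p, hp, q, hq, rfl⟩,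
      hj _ ⟨p, hp, q, hq, rfl⟩ p q rfl⟩⟩⟩
  · exact ⟨∅, fun _ => ∅, id, fun h' => absurd h' h⟩

theorem card_range_Iio_le (κ : Cardinal.{u}) (f : Set.Iio (Order.succ κ).ord → ZFSet.{u}) :
    (ZFSet.range f).card ≤ 2 ^ κ := by
  refine le_trans ?_ (Order.succ_le_of_lt (cantor κ))
  have h := ZFSet.lift_card_range_le (f := f)
  rw [Cardinal.mk_Iio_ordinal, card_ord, lift_id'.{u, u + 1}] at h
  exact lift_le.1 h

end WeakReflection

theorem mainTheorem4 (κ : Cardinal.{u}) (hreg : κ.IsRegular) (hκ : κ ^< κ = κ)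
    (P : WeakReflection.Forcing.{u}) (hlat : P.IsLattice κ) (hprop : P.IsStronglyProper κ)
    (D : Set.Iio (Order.succ κ).ord → ZFSet.{u})
    (hD : ∀ α, P.IsDense (D α) ∧ P.IsOpen (D α)) :
    ∃ (Pstar : WeakReflection.Forcing.{u}) (Dstar : Set.Iio (Order.succ κ).ord → ZFSet.{u}),
      Pstar.IsSuborder P ∧ Pstar.IsLattice κ ∧ Pstar.IsStronglyProper κ ∧
      Pstar.carrier.card = min P.carrier.card (2 ^ κ) ∧
      (∀ α, Pstar.IsDense (Dstar α)) ∧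
      ((∃ G, Pstar.IsGenericFilter Dstar G) ↔ ∃ G, P.IsGenericFilter D G) := by
  open WeakReflection in
  rcases le_or_gt P.carrier.card (2 ^ κ) with hsize | hsize
  · exact ⟨P, D, ⟨fun _ hp => hp, fun _ _ _ _ => Iff.rfl⟩, hlat, hprop, (min_eq_left hsize).symm,
      fun α => (hD α).1, Iff.rfl⟩
  have h2 : ℵ₀ ≤ (2 : Cardinal.{u}) ^ κ := hreg.1.trans (cantor κ).le
  have : Nonempty (Set.Iio (Order.succ κ).ord) :=
    ⟨⟨0, (isRegular_succ hreg.1).ord_pos⟩⟩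
  obtain ⟨μ, hμ, hPμ⟩ := exists_mem_H_succ κ P.code
  obtain ⟨Sk, hSkH, hSk₀, hSk⟩ := exists_skolem_function (Order.succ μ) hPμ
  obtain ⟨S, hSP, hSc⟩ := exists_subset_card_eq hsize.le
  -- The choices are fixed before it is known whether a generic filter exists, since `N` must serve
  -- both directions.
  obtain ⟨G, g, j, hG⟩ := exists_filter_choice P D
  have hdense : ∀ α, ∀ p ∈ P.carrier, ∃ d ∈ D α, P.le d p := fun α => (hD α).1.2
  choose! d hdD hdle using hdense
  obtain ⟨N, hNc, hN, hΨ⟩ := exists_isReflectingSet hreg.1 hμ hPμ hSkH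
    -- The set `S` secures size `2 ^ κ`, the `d α` secure density, and `j` and `g` make the trace of
    -- `G` a generic filter. Intersecting with the conditions discards default values.
    (fun x => ((S ∪ {j x, j x}) ∪ (ZFSet.range (fun α => d α x) ∪ ZFSet.range g)) ∩ P.carrier)
    (fun x => (ZFSet.card_mono fun z hz => (ZFSet.mem_inter.1 hz).1).trans
      (card_union_le_of_le h2 (card_union_le_of_le h2 hSc.le (card_upair_lt _ _ h2).le)
        (card_union_le_of_le h2 (card_range_Iio_le κ _) (card_range_Iio_le κ _))))
    (fun x z hz => (ZFSet.mem_inter.1 hz).2)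
  simp only [ZFSet.subset_def, ZFSet.mem_inter, ZFSet.mem_union, ZFSet.mem_pair,
    ZFSet.mem_range] at hΨ
  -- The parts `S` and `range g` do not depend on the argument, so evaluation at `∅` puts them into
  -- `N`.
  have hempty : ∅ ∈ N := hN.mem_of_subset ∅ (ZFSet.empty_subset _) (by simp)
  have hSN : S ⊆ (P.restrict N).carrier := fun x hx =>
    Forcing.mem_carrier_restrict.2 ⟨hSP hx, hΨ ∅ hempty ⟨Or.inl (Or.inl hx), hSP hx⟩⟩
  have hC : (P.restrict N).carrier.card = 2 ^ κ :=
    le_antisymm ((ZFSet.card_mono fun x hx => (Forcing.mem_carrier_restrict.1 hx).2).trans hNc)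
      (hSc ▸ ZFSet.card_mono hSN)
  refine ⟨P.restrict N, fun α => D α ∩ N, P.restrict_isSuborder N, hN.isLattice_restrict hlat,
    hN.isStronglyProper_restrict hreg hκ hlat hprop hSk₀ (fun M => hSk κ M hreg.1) hNc hC,
    hC.trans (min_eq_right hsize.le).symm, fun α => ⟨fun p hp => ?_, fun p hp => ?_⟩,
    exists_genericFilter_of_restrict, fun hex => ⟨G ∩ N, ?_⟩⟩
  · rw [ZFSet.mem_inter] at hp
    exact Forcing.mem_carrier_restrict.2 ⟨(hD α).1.1 hp.1, hp.2⟩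
  · obtain ⟨hpP, hpN⟩ := Forcing.mem_carrier_restrict.1 hp
    have hdP : d α p ∈ P.carrier := (hD α).1.1 (hdD α p hpP)
    have hdN : d α p ∈ N := hΨ p hpN ⟨Or.inr (Or.inl ⟨α, rfl⟩), hdP⟩
    exact ⟨d α p, ZFSet.mem_inter.2 ⟨hdD α p hpP, hdN⟩, Forcing.restrict_le.2
      ⟨hdle α p hpP, Forcing.mem_carrier_restrict.2 ⟨hdP, hdN⟩, hp⟩⟩
  · obtain ⟨hGf, hg, hj⟩ := hG hex
    have hGP := hGf.1.1
    refine isGenericFilter_restrict hGf (fun α => ⟨g α, (hg α).1, (hg α).2, ?_⟩)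
      fun p hp hpN q hq hqN => ?_
    · exact hΨ ∅ hempty ⟨Or.inr (Or.inr ⟨α, rfl⟩), hGP (hg α).1⟩
    · obtain ⟨hjG, hjp, hjq⟩ := hj p hp q hq
      have hpq : ZFSet.pair p q ∈ N := ContainsSmallSubsets.pair_mem (κ := κ)
        (fun b hb hbc => hN.mem_of_subset b hb hbc.le) hreg.1 hpN hqN
      exact ⟨_, hjG, hΨ _ hpq ⟨Or.inl (Or.inr (Or.inl rfl)), hGP hjG⟩, hjp, hjq⟩
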